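/- **Theorem (quantitative rigidity).** Let $n\ge 0$. Write $B_R=B_R(0^n)\subset\mathbb R^n$ for open balls. A $k$-varifold on an open set $U\subseteq\mathbb R^n$ is a Radon measure on $U\times G(n,k)$, where $G(n,k)$ is the Grassmannian of $k$-dimensional linear subspaces of $\mathbb R^n$. For each $k$ and $R>0$ let $d_*$ be a fixed distance function on the $k$-varifolds on $B_R$ that induces the weak* topology. For an integer multiplicity rectifiable $k$-current $I$ of finite mass in $\mathbb R^n$ let $|I|$ be the associated varifold, write $|I|(A)$ for $|I|(A\times G(n,k))$, and put $\theta_r(0^n)=r^{-k}|I|(B_r)$. For all $\Lambda,\epsilon>0$ there exist $\delta=\delta(n,\Lambda,\epsilon)>0$ and $r=r(n,\Lambda,\epsilon)\in(0,1)$ (for the fixed distance functions $d_*$) such that the following holds for every $k$. Let $I$ be an integral $k$-current in $\mathbb R^n$ (that is, $I$ is integer multiplicity rectifiable of finite mass and, if $k\ge1$, so is $\partial I$) with support in $\overline{B_2}$ and with $\operatorname{spt}\partial I\subseteq\partial B_2$. Suppose that $I$ is stationary in $B_2$, i.e. $\int \operatorname{div}_S X(x)\,d|I|(x,S)=0$ for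 every smooth vector field $X$ with compact support in $B_2$, and that $|I|(B_2)<\Lambda$. If $$\theta_1(0^n)-\theta_r(0^n)\le\delta ,$$ then $I$ is $(\epsilon,1,0)$-conical at $0^n$: there is a $k$-varifold $J$ on $\mathbb R^n$, invariant under push-forward by all dilations $x\mapsto\lambda x$, $\lambda>0$, such that the restrictions of $|I|$ and $J$ to $B_1$ satisfy $$d_*\big(|I|\llcorner B_1,\;J\llcorner B_1\big)<\epsilon .$$ -/

import Mathlib

open Set Filter Topology MeasureTheory Metric
open scoped ContDiff

noncomputable section

/-- Euclidean space `ℝⁿ`. -/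
abbrev Euc (n : ℕ) : Type := EuclideanSpace ℝ (Fin n)

/-! ## The Grassmannian -/

/-- The Grassmannian of (unoriented) `k`-dimensional linear subspaces of `ℝⁿ`. -/
def Gr (n k : ℕ) : Type := {S : Submodule ℝ (Euc n) // Module.finrank ℝ S = k}

/-- The orthogonal projection of `ℝⁿ` onto the plane `S`. -/
def Gr.proj {n k : ℕ} (S : Gr n k) : Euc n →L[ℝ] Euc n := S.1.starProjection

/-- The usual topology: planes are close when their orthogonal projections are close in
operator norm. -/
instance (n k : ℕ) : TopologicalSpace (Gr n k) := TopologicalSpace.induced Gr.proj inferInstance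

instance (n k : ℕ) : MeasurableSpace (Gr n k) := borel _

instance (n k : ℕ) : BorelSpace (Gr n k) := ⟨rfl⟩

/-! ## Varifolds -/

/-- A `k`-varifold on an open set `U ⊆ ℝⁿ`: a Radon measure on `U × Gr n k`. It is represented by
its extension by zero to `ℝⁿ × Gr n k`. (As `Gr n k` is compact, finiteness on the sets `K × Gr n k`
with `K ⊆ U` compact is local finiteness on `U × Gr n k`.) -/
@[ext]
structure Varifold (n k : ℕ) (U : Set (Euc n)) where
  toMeasure : Measure (Euc n × Gr n k)
  null_outside : toMeasure (U ×ˢ (univ : Set (Gr n k)))ᶜ = 0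
  finite_on_compacts : ∀ K : Set (Euc n), K ⊆ U → IsCompact K →
    toMeasure (K ×ˢ (univ : Set (Gr n k))) < ⊤

namespace Varifold

variable {n k : ℕ}

/-- The weak* topology on varifolds on `U`: the coarsest topology for which `V ↦ ∫ φ dV` is
continuous for every continuous `φ` with compact support in `U × Gr n k`. -/
instance (U : Set (Euc n)) : TopologicalSpace (Varifold n k U) :=
  ⨅ φ : {φ : Euc n × Gr n k → ℝ // Continuous φ ∧ HasCompactSupport φ ∧
      tsupport φ ⊆ U ×ˢ (univ : Set (Gr n k))},
    TopologicalSpace.induced (fun V : Varifold n k U => ∫ p, φ.1 p ∂V.toMeasure) inferInstance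

/-- The weight (mass) `‖V‖(A) = V(A × Gr n k)`. -/
def weight {U : Set (Euc n)} (V : Varifold n k U) (A : Set (Euc n)) : ENNReal :=
  V.toMeasure (A ×ˢ (univ : Set (Gr n k)))

/-- The restriction to an open ball of a varifold on `ℝⁿ`. -/
def restrictBall (V : Varifold n k univ) (R : ℝ) : Varifold n k (ball 0 R) where
  toMeasure := V.toMeasure.restrict (ball 0 R ×ˢ (univ : Set (Gr n k)))
  null_outside := by
    have h : MeasurableSet (ball (0 : Euc n) R ×ˢ (univ : Set (Gr n k))) :=
      measurableSet_ball.prod MeasurableSet.univ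
    rw [Measure.restrict_apply h.compl]
    simp
  finite_on_compacts K _ hK :=
    (Measure.restrict_apply_le _ _).trans_lt (V.finite_on_compacts K (subset_univ K) hK)

/-- The blow-up of `V` at `y` at scale `r`: the push-forward `r⁻ᵏ (η_{y,r})_* V` of the varifold `V`
under `η_{y,r} (x) = (x - y) / r`. -/
def rescale (V : Varifold n k univ) (y : Euc n) (r : ℝ) (hr : 0 < r) : Varifold n k univ where
  toMeasure := (ENNReal.ofReal (r ^ k))⁻¹ •
    V.toMeasure.map (fun p : Euc n × Gr n k => (r⁻¹ • (p.1 - y), p.2))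
  null_outside := by simp
  finite_on_compacts K _ hK := by
    have hm : Measurable (fun p : Euc n × Gr n k => (r⁻¹ • (p.1 - y), p.2)) := by fun_prop
    have hpre : (fun p : Euc n × Gr n k => (r⁻¹ • (p.1 - y), p.2)) ⁻¹'
        (K ×ˢ (univ : Set (Gr n k))) ⊆ ((fun x => r • x + y) '' K) ×ˢ univ := by
      rintro ⟨x, S⟩ h
      refine ⟨⟨r⁻¹ • (x - y), h.1, ?_⟩, mem_univ _⟩
      simp [smul_smul, hr.ne']
    have hK' : IsCompact ((fun x : Euc n => r • x + y) '' K) := hK.image (by fun_prop)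
    rw [Measure.smul_apply, smul_eq_mul, Measure.map_apply hm
      (hK.measurableSet.prod MeasurableSet.univ)]
    refine ENNReal.mul_lt_top ?_ ((measure_mono hpre).trans_lt
      (V.finite_on_compacts _ (subset_univ _) hK'))
    simp [pow_pos hr k]

/-- The density ratio `θ_r(x) = r⁻ᵏ ‖V‖(B_r(x))`. -/
def density (V : Varifold n k univ) (r : ℝ) (x : Euc n) : ℝ :=
  (r ^ k)⁻¹ * (V.weight (ball x r)).toReal

/-- `V` is stationary in `U`: the first variation `δV(X) = ∫ div_S X(x) dV(x,S)` vanishes for every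
smooth vector field `X` with compact support in `U`; here `div_S X = trace (P_S ∘ DX)` is the
divergence of `X` along the plane `S`. -/
def IsStationaryIn (V : Varifold n k univ) (U : Set (Euc n)) : Prop :=
  ∀ X : Euc n → Euc n, ContDiff ℝ ∞ X → HasCompactSupport X → tsupport X ⊆ U →
    ∫ p, LinearMap.trace ℝ (Euc n) (p.2.proj ∘L fderiv ℝ X p.1 : Euc n →L[ℝ] Euc n).toLinearMap
      ∂V.toMeasure = 0

/-- A varifold `V` on `ℝⁿ` is `l`-conical (at the origin): it is invariant under push-forward by all
dilations `x ↦ λ x`, `λ > 0` (the push-forward of varifolds carries the Jacobian factor `λᵏ`), and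
under translations by the vectors of some `l`-dimensional linear subspace `W`. -/
def IsConical (l : ℕ) (V : Varifold n k univ) : Prop :=
  (∀ c : ℝ, 0 < c →
    ENNReal.ofReal (c ^ k) • V.toMeasure.map (fun p : Euc n × Gr n k => (c • p.1, p.2))
      = V.toMeasure) ∧
  ∃ W : Submodule ℝ (Euc n), Module.finrank ℝ W = l ∧ ∀ w ∈ W,
    V.toMeasure.map (fun p : Euc n × Gr n k => (p.1 + w, p.2)) = V.toMeasure

/-- `d` is a distance function on the varifolds on `U` which induces the weak* topology. -/
structure IsWeakStarDistance {U : Set (Euc n)}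
    (d : Varifold n k U → Varifold n k U → ℝ) : Prop where
  eq_zero_iff : ∀ V W, d V W = 0 ↔ V = W
  symm : ∀ V W, d V W = d W V
  triangle : ∀ V W Z, d V Z ≤ d V W + d W Z
  isOpen_iff : ∀ s : Set (Varifold n k U),
    IsOpen s ↔ ∀ V ∈ s, ∃ ρ > 0, ∀ W, d V W < ρ → W ∈ s

/-- `V` is `(η, r, l)`-conical at `y`: on the ball of radius `r⁻¹` about the origin, the blow-up of
`V` at `y` at scale `r` is `η`-close to some `l`-conical varifold `J` on `ℝⁿ`. The distance used on
varifolds on the ball of radius `R` is `d R`. -/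
def IsAlmostConical
    (d : ∀ R : ℝ, Varifold n k (ball 0 R) → Varifold n k (ball 0 R) → ℝ)
    (V : Varifold n k univ) (η r : ℝ) (hr : 0 < r) (l : ℕ) (y : Euc n) : Prop :=
  ∃ J : Varifold n k univ, J.IsConical l ∧
    d r⁻¹ ((V.rescale y r hr).restrictBall r⁻¹) (J.restrictBall r⁻¹) < η

end Varifold

/-! ## Integral currents -/

/-- `α` is a test form: a smooth, compactly supported differential `k`-form on `ℝⁿ`. -/
def IsTestForm {n k : ℕ} (α : Euc n → Euc n [⋀^Fin k]→L[ℝ] ℝ) : Prop :=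
  ContDiff ℝ ∞ α ∧ HasCompactSupport α

/-- A set `M ⊆ ℝⁿ` is countably `k`-rectifiable: up to a `ℋᵏ`-null set it is covered by countably
many Lipschitz images of `ℝᵏ`. -/
def IsCountablyRectifiable {n : ℕ} (k : ℕ) (M : Set (Euc n)) : Prop :=
  ∃ f : ℕ → Euc k → Euc n, (∀ j, ∃ K, LipschitzWith K (f j)) ∧
    μHE[k] (M \ ⋃ j, range (f j)) = 0

/-- An integer multiplicity rectifiable `k`-current (of finite mass) in `ℝⁿ`. It is carried by the
countably `k`-rectifiable set `M = {mult ≠ 0}`, with integer multiplicity `mult`, and is oriented by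
the simple unit `k`-vector field `e₁ ∧ ⋯ ∧ e_k`, where `e₁, …, e_k` is the orthonormal frame `frame`
(whose values off `M` are irrelevant), which spans the approximate tangent plane of `M` with
multiplicity `|mult|` at `ℋᵏ`-almost every point of `M`. The multiplicity is allowed to be negative,
so that for `k = 0` both orientations of a point occur. -/
structure RectifiableCurrent (n k : ℕ) where
  mult : Euc n → ℤ
  frame : Euc n → Fin k → Euc n
  measurable_mult : Measurable mult
  measurable_frame : Measurable frame
  integrable_mult : Integrable (fun x => (mult x : ℝ)) μHE[k]
  rectifiable : IsCountablyRectifiable k {x | mult x ≠ 0}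
  orthonormal : ∀ x, Orthonormal ℝ (frame x)
  approx_tangent : ∀ᵐ x ∂(μHE[k] : Measure (Euc n)), mult x ≠ 0 →
    ∀ φ : Euc n → ℝ, Continuous φ → HasCompactSupport φ →
      Tendsto (fun r : ℝ => (r ^ k)⁻¹ * ∫ y, |(mult y : ℝ)| * φ (r⁻¹ • (y - x)) ∂μHE[k])
        (𝓝[>] 0)
        (𝓝 (|(mult x : ℝ)| *
          ∫ y in (Submodule.span ℝ (range (frame x)) : Set (Euc n)), φ y ∂μHE[k]))

namespace RectifiableCurrent

variable {n k : ℕ}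

/-- The action of a current on a `k`-form, `I(α) = ∫ mult ⟨α, e₁ ∧ ⋯ ∧ e_k⟩ dℋᵏ`. -/
def eval (I : RectifiableCurrent n k) (α : Euc n → Euc n [⋀^Fin k]→L[ℝ] ℝ) : ℝ :=
  ∫ x, (I.mult x : ℝ) * α x (I.frame x) ∂μHE[k]

/-- The support of `I` is contained in the closed set `C`. -/
def SupportedIn (I : RectifiableCurrent n k) (C : Set (Euc n)) : Prop :=
  ∀ α : Euc n → Euc n [⋀^Fin k]→L[ℝ] ℝ, IsTestForm α → Disjoint (tsupport α) C → I.eval α = 0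

/-- `I` is an integral current: its boundary `∂I(α) = I(dα)` is again an integer multiplicity
rectifiable current (no condition if `k = 0`, where `∂I = 0`). -/
def IsIntegral : {k : ℕ} → RectifiableCurrent n k → Prop
  | 0, _ => True
  | j + 1, I => ∃ B : RectifiableCurrent n j,
      ∀ α : Euc n → Euc n [⋀^Fin j]→L[ℝ] ℝ, IsTestForm α → B.eval α = I.eval (extDeriv α)

/-- The support of the boundary `∂I(α) = I(dα)` is contained in the closed set `C`. -/
def BoundarySupportedIn : {k : ℕ} → RectifiableCurrent n k → Set (Euc n) → Prop
  | 0, _, _ => True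
  | j + 1, I, C => ∀ α : Euc n → Euc n [⋀^Fin j]→L[ℝ] ℝ, IsTestForm α →
      Disjoint (tsupport α) C → I.eval (extDeriv α) = 0

/-- The plane spanned by the frame at `x`. -/
def plane (I : RectifiableCurrent n k) (x : Euc n) : Gr n k :=
  ⟨Submodule.span ℝ (range (I.frame x)), by
    rw [finrank_span_eq_card (I.orthonormal x).linearIndependent, Fintype.card_fin]⟩

theorem measurable_plane (I : RectifiableCurrent n k) : Measurable I.plane := by
  have h : Measurable (fun x => (I.plane x).proj) := by
    have hs : (fun x => (I.plane x).proj) = fun x =>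
        ∑ i, (innerSL ℝ (I.frame x i)).smulRight (I.frame x i) := by
      funext x
      refine ContinuousLinearMap.ext fun v => ?_
      refine (Submodule.eq_starProjection_of_mem_of_inner_eq_zero
        (K := Submodule.span ℝ (range (I.frame x))) (u := v) (v := _) ?_ ?_)
      · simp only [sum_apply, ContinuousLinearMap.smulRight_apply]
        exact Submodule.sum_mem _ fun i _ =>
          Submodule.smul_mem _ _ (Submodule.subset_span ⟨i, rfl⟩)
      · intro w hw
        induction hw using Submodule.span_induction with
        | mem w hw =>
          obtain ⟨j, rfl⟩ := hw
          have ho := orthonormal_iff_ite.1 (I.orthonormal x)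
          simp [inner_sub_left, sum_inner, inner_smul_left, ho, real_inner_comm]
        | zero => simp
        | add a b _ _ ha hb => rw [inner_add_right, ha, hb, add_zero]
        | smul c a _ ha => rw [inner_smul_right, ha, mul_zero]
    rw [hs]
    have hc : Continuous (fun f : Fin k → Euc n =>
        ∑ i, (innerSL ℝ (f i)).smulRight (f i)) := by
      refine continuous_finsetSum _ fun i _ => ?_
      have h1 : Continuous (fun f : Fin k → Euc n => innerSL ℝ (f i)) :=
        (innerSL ℝ).continuous.comp (continuous_apply i)
      exact ((ContinuousLinearMap.smulRightL ℝ (Euc n) (Euc n)).continuous.comp h1).clm_apply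
        (continuous_apply i)
    exact hc.measurable.comp I.measurable_frame
  refine measurable_of_isOpen fun s hs => ?_
  obtain ⟨t, ht, rfl⟩ := isOpen_induced_iff.1 hs
  exact h ht.measurableSet

/-- The varifold `|I|` associated with `I`: `∫ φ d|I| = ∫ φ(x, T_x I) |mult x| dℋᵏ(x)`. -/
def varifold (I : RectifiableCurrent n k) : Varifold n k univ where
  toMeasure := ((μHE[k] : Measure (Euc n)).withDensity
    (fun x => ENNReal.ofReal |(I.mult x : ℝ)|)).map (fun x => (x, I.plane x))
  null_outside := by simp
  finite_on_compacts K _ _ := by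
    have : IsFiniteMeasure ((μHE[k] : Measure (Euc n)).withDensity
        (fun x => ENNReal.ofReal |(I.mult x : ℝ)|)) :=
      isFiniteMeasure_withDensity_ofReal I.integrable_mult.abs.2
    exact measure_lt_top _ _

end RectifiableCurrent

end

/-!
The proof is by compactness. If the claim failed for some `k`, there would be stationary currents
`I_j` of mass less than `Λ` whose density ratios at `0` are closer and closer to constant on `[r_j,
1]`, with `r_j → 0`, but which stay away from all cones. Their varifolds converge weak* along an
ultrafilter to a finite measure `V` (`exists_ultrafilter_limit`), which is again stationary in
`B_2`. It suffices to show that `V` agrees on `B_1` with a conical varifold.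

*The weight is conical.* By the monotonicity formula (`StationaryIn.densityRatio_mono`) the density
ratio of `V` at `0` is constant (`WeakLimit.ball_eq`), so the error term of that formula vanishes:
almost every plane contains its base point (`StationaryIn.ae_mem_plane`). For such a varifold the
first variation in direction `φ(x) x` says that the weight `‖V‖` scales with exponent `k`
(`StationaryIn.conicalInBall`).

*The planes are determined by the weight.* This is where integrality enters, and it is not true for
general stationary varifolds. By the approximate tangent planes and monotonicity, the currents have
density ratios bounded below (`RectifiableCurrent.ae_tentMass_le_densityRatio`), and so has `V`
(`WeakLimit.lower_density`). Let `A(x)` be the mean of the projections onto the planes of `V` over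
`x`. At a Lebesgue point `a` of `A`, stationarity shows that the blow-ups of `‖V‖` are
asymptotically invariant in the directions of the range of `A(a)`
(`StationaryIn.meanProj_mem_tangentDirections`). The space `D(a)` of all such directions
(`tangentDirections`) has dimension at most `k`, since otherwise the density ratios would blow up
logarithmically (`finrank_tangentDirections_le`). If the mean of projections onto `k`-planes has
range in a space of dimension at most `k`, almost all of the planes are that space
(`ae_eq_of_integral_proj_mem`). So `V` is carried by the graph of `D`, which depends on `‖V‖` alone
(`StationaryIn.ae_eq_tangentDirections`).

As `‖V‖` is conical in `B_1`, so is `D`, and two measures with the same weight carried by the same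
graph coincide (`measure_eq_of_ae_graph`); hence `V` is conical in `B_1`, and it extends to a cone
on `ℝⁿ` (`exists_conical_extension`).
-/

noncomputable section

/-! ### Topology of the Grassmannian -/

section Grassmannian

variable {n k : ℕ}

theorem Gr.proj_injective : Function.Injective (Gr.proj : Gr n k → Euc n →L[ℝ] Euc n) := by
  intro S T h
  apply Subtype.ext
  have hS := Submodule.range_starProjection S.1
  have hT := Submodule.range_starProjection T.1
  rw [← hS, ← hT]
  exact congrArg (fun L : Euc n →L[ℝ] Euc n => L.range) h

theorem Gr.trace_proj (S : Gr n k) :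
    LinearMap.trace ℝ (Euc n) (S.proj : Euc n →L[ℝ] Euc n).toLinearMap = k := by
  have hp : LinearMap.IsProj S.1 (S.proj : Euc n →L[ℝ] Euc n).toLinearMap :=
    ⟨fun x => Submodule.starProjection_apply_mem _ x,
      fun x hx => Submodule.starProjection_eq_self_iff.2 hx⟩
  rw [hp.trace, S.2]

/-- The projections onto `k`-planes are the symmetric idempotents of trace `k`. -/
theorem Gr.range_proj : range (Gr.proj : Gr n k → Euc n →L[ℝ] Euc n) =
    {L | L * L = L ∧ (∀ x y, inner ℝ (L x) y = inner ℝ x (L y)) ∧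
      LinearMap.trace ℝ (Euc n) L.toLinearMap = k} := by
  ext L
  constructor
  · rintro ⟨S, rfl⟩
    exact ⟨S.1.isIdempotentElem_starProjection,
      fun x y => Submodule.inner_starProjection_left_eq_right _ x y, S.trace_proj⟩
  · rintro ⟨h1, h2, h3⟩
    have hs : IsStarProjection L :=
      ⟨h1, (ContinuousLinearMap.isSelfAdjoint_iff_isSymmetric).2 h2⟩
    obtain ⟨K, hK, rfl⟩ := isStarProjection_iff_eq_starProjection.1 hs
    have hp : LinearMap.IsProj K (K.starProjection : Euc n →L[ℝ] Euc n).toLinearMap :=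
      ⟨fun x => Submodule.starProjection_apply_mem _ x,
        fun x hx => Submodule.starProjection_eq_self_iff.2 hx⟩
    rw [hp.trace] at h3
    exact ⟨⟨K, by exact_mod_cast h3⟩, rfl⟩

theorem continuous_trace_clm :
    Continuous (fun L : Euc n →L[ℝ] Euc n => LinearMap.trace ℝ (Euc n) L.toLinearMap) :=
  ((LinearMap.trace ℝ (Euc n)).comp
    (ContinuousLinearMap.coeLM ℝ)).continuous_of_finiteDimensional

theorem Gr.isClosedEmbedding_proj :
    IsClosedEmbedding (Gr.proj : Gr n k → Euc n →L[ℝ] Euc n) := by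
  refine ⟨⟨⟨rfl⟩, Gr.proj_injective⟩, ?_⟩
  rw [Gr.range_proj]
  refine (isClosed_eq (by fun_prop) continuous_id).inter (IsClosed.inter ?_ ?_)
  · have h : {L : Euc n →L[ℝ] Euc n | ∀ x y, inner ℝ (L x) y = inner ℝ x (L y)} =
        ⋂ x, ⋂ y, {L : Euc n →L[ℝ] Euc n | inner ℝ (L x) y = inner ℝ x (L y)} := by
      ext L; simp
    change IsClosed {L : Euc n →L[ℝ] Euc n | ∀ x y, inner ℝ (L x) y = inner ℝ x (L y)}
    exact h.symm ▸ isClosed_iInter fun x => isClosed_iInter fun y =>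
      isClosed_eq (by fun_prop) (by fun_prop)
  · exact isClosed_eq continuous_trace_clm continuous_const

theorem Gr.continuous_proj : Continuous (Gr.proj : Gr n k → Euc n →L[ℝ] Euc n) :=
  Gr.isClosedEmbedding_proj.continuous

theorem Gr.norm_proj_le (S : Gr n k) : ‖S.proj‖ ≤ 1 := Submodule.starProjection_norm_le _

instance : CompactSpace (Gr n k) := by
  refine ⟨?_⟩
  have h := (Gr.isClosedEmbedding_proj (n := n) (k := k)).isCompact_preimage
    (isCompact_closedBall (0 : Euc n →L[ℝ] Euc n) 1)
  convert h
  ext S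
  simpa using S.norm_proj_le

instance : PolishSpace (Gr n k) := Gr.isClosedEmbedding_proj.polishSpace

end Grassmannian

/-! ### First variation and monotonicity -/

section FirstVariation

variable {n k : ℕ}

/-- Stationarity in `U` of a varifold, in terms of the underlying measure on `ℝⁿ × Gr n k`. -/
def StationaryIn (V : Measure (Euc n × Gr n k)) (U : Set (Euc n)) : Prop :=
  ∀ X : Euc n → Euc n, ContDiff ℝ ∞ X → HasCompactSupport X → tsupport X ⊆ U →
    ∫ p, LinearMap.trace ℝ (Euc n) (p.2.proj ∘L fderiv ℝ X p.1 : Euc n →L[ℝ] Euc n).toLinearMap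
      ∂V = 0

theorem trace_proj_comp_smulRight (P : Euc n →L[ℝ] Euc n) (l : Euc n →L[ℝ] ℝ) (w : Euc n) :
    LinearMap.trace ℝ (Euc n) (P ∘L l.smulRight w : Euc n →L[ℝ] Euc n).toLinearMap = l (P w) := by
  have h : (P ∘L l.smulRight w : Euc n →L[ℝ] Euc n).toLinearMap
      = (l.toLinearMap).smulRight (P w) := by
    ext x; simp
  rw [h, LinearMap.trace_smulRight]
  rfl

/-- The first variation in direction of a compactly supported function times a constant vector. -/
theorem StationaryIn.integral_fderiv_proj {V : Measure (Euc n × Gr n k)} {U : Set (Euc n)}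
    (hV : StationaryIn V U) {φ : Euc n → ℝ} (hφ : ContDiff ℝ ∞ φ) (hc : HasCompactSupport φ)
    (hs : tsupport φ ⊆ U) (e : Euc n) : ∫ p, fderiv ℝ φ p.1 (p.2.proj e) ∂V = 0 := by
  have h := hV (fun x => φ x • e) (by fun_prop) hc.smul_right
    ((tsupport_smul_subset_left φ fun _ => e).trans hs)
  rw [← h]
  refine integral_congr_ae (Eventually.of_forall fun p => ?_)
  have hd : fderiv ℝ (fun x => φ x • e) p.1 = (fderiv ℝ φ p.1).smulRight e :=
    ((hφ.differentiable (by simp) p.1).hasFDerivAt.smul_const e).fderiv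
  simp only
  rw [hd, trace_proj_comp_smulRight]

/-- The first variation in direction of a compactly supported function times the radial field. -/
theorem StationaryIn.integral_radial {V : Measure (Euc n × Gr n k)} {U : Set (Euc n)}
    (hV : StationaryIn V U) {φ : Euc n → ℝ} (hφ : ContDiff ℝ ∞ φ) (hc : HasCompactSupport φ)
    (hs : tsupport φ ⊆ U) (a : Euc n) :
    ∫ p, (k * φ p.1 + fderiv ℝ φ p.1 (p.2.proj (p.1 - a))) ∂V = 0 := by
  have h := hV (fun x => φ x • (x - a)) (by fun_prop) hc.smul_right
    ((tsupport_smul_subset_left φ fun x => x - a).trans hs)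
  rw [← h]
  refine integral_congr_ae (Eventually.of_forall fun p => ?_)
  have hd : fderiv ℝ (fun x => φ x • (x - a)) p.1 =
      φ p.1 • ContinuousLinearMap.id ℝ (Euc n) + (fderiv ℝ φ p.1).smulRight (p.1 - a) :=
    ((hφ.differentiable (by simp) p.1).hasFDerivAt.smul
      ((hasFDerivAt_id p.1).sub_const a)).fderiv
  simp only
  rw [hd, ContinuousLinearMap.comp_add, ContinuousLinearMap.toLinearMap_add, map_add,
    trace_proj_comp_smulRight, ContinuousLinearMap.comp_smul, ContinuousLinearMap.comp_id,
    ContinuousLinearMap.toLinearMap_smul, map_smul, Gr.trace_proj, smul_eq_mul, mul_comm]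

theorem HasCompactSupport.comp_scale {E : Type*} [Zero E] {φ : Euc n → E}
    (hc : HasCompactSupport φ)
    {ρ : ℝ} (hρ : 0 < ρ) (a : Euc n) : HasCompactSupport (fun x => φ (ρ⁻¹ • (x - a))) := by
  exact hc.comp_homeomorph
    ((Homeomorph.subRight a).trans (Homeomorph.smulOfNeZero ρ⁻¹ (inv_ne_zero hρ.ne')))

theorem integrable_of_hasCompactSupport_fst {V : Measure (Euc n × Gr n k)} [IsFiniteMeasure V]
    {φ : Euc n → ℝ} (hφ : Continuous φ) (hc : HasCompactSupport φ) :
    Integrable (fun p => φ p.1) V := by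
  obtain ⟨C, hC⟩ := hφ.bounded_above_of_compact_support hc
  exact Integrable.of_bound (hφ.comp continuous_fst).aestronglyMeasurable C
    (Eventually.of_forall fun p => hC p.1)

theorem fderiv_comp_scale {φ : Euc n → ℝ} (hφ : ContDiff ℝ ∞ φ) (ρ : ℝ) (a x w : Euc n) :
    fderiv ℝ (fun x => φ (ρ⁻¹ • (x - a))) x w = fderiv ℝ φ (ρ⁻¹ • (x - a)) (ρ⁻¹ • w) := by
  have h1 : HasFDerivAt (fun x : Euc n => ρ⁻¹ • (x - a))
      (ρ⁻¹ • ContinuousLinearMap.id ℝ (Euc n)) x :=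
    ((hasFDerivAt_id x).sub_const a).const_smul ρ⁻¹
  have h2 := ((hφ.differentiable (by simp) (ρ⁻¹ • (x - a))).hasFDerivAt).comp x h1
  have h3 := h2.fderiv
  simp only [Function.comp_def] at h3
  rw [h3]
  simp

theorem continuous_fderiv_apply_self {φ : Euc n → ℝ} (hφ : ContDiff ℝ ∞ φ) :
    Continuous (fun y => fderiv ℝ φ y y) :=
  (hφ.continuous_fderiv (by simp)).clm_apply continuous_id

theorem hasCompactSupport_fderiv_apply_self {φ : Euc n → ℝ} (hc : HasCompactSupport φ) :
    HasCompactSupport (fun y => fderiv ℝ φ y y) := by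
  refine (hc.fderiv ℝ).mono fun y hy => ?_
  contrapose! hy
  rw [Function.notMem_support] at hy ⊢
  simp [hy]

/-- Differentiation of a scaled integral with respect to the scale. -/
theorem hasDerivAt_integral_scale {V : Measure (Euc n × Gr n k)} [IsFiniteMeasure V]
    {φ : Euc n → ℝ} (hφ : ContDiff ℝ ∞ φ) (hc : HasCompactSupport φ) (a : Euc n)
    {ρ : ℝ} (hρ : 0 < ρ) :
    HasDerivAt (fun ρ : ℝ => ∫ p, φ (ρ⁻¹ • (p.1 - a)) ∂V)
      (∫ p, -ρ⁻¹ * fderiv ℝ φ (ρ⁻¹ • (p.1 - a)) (ρ⁻¹ • (p.1 - a)) ∂V) ρ := by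
  have hcont := continuous_fderiv_apply_self hφ
  obtain ⟨C, hC⟩ := hcont.bounded_above_of_compact_support (hasCompactSupport_fderiv_apply_self hc)
  have hC0 : 0 ≤ C := (norm_nonneg _).trans (hC 0)
  refine (hasDerivAt_integral_of_dominated_loc_of_deriv_le (s := Ioi (ρ / 2))
    (F := fun (ρ : ℝ) (p : Euc n × Gr n k) => φ (ρ⁻¹ • (p.1 - a)))
    (F' := fun (ρ : ℝ) (p : Euc n × Gr n k) =>
      -ρ⁻¹ * fderiv ℝ φ (ρ⁻¹ • (p.1 - a)) (ρ⁻¹ • (p.1 - a)))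
    (bound := fun _ => (ρ / 2)⁻¹ * C) (Ioi_mem_nhds (by linarith)) ?_ ?_ ?_ ?_ ?_ ?_).2
  · refine Eventually.of_forall fun r => Continuous.aestronglyMeasurable ?_
    exact hφ.continuous.comp (by fun_prop)
  · exact integrable_of_hasCompactSupport_fst (φ := fun x => φ (ρ⁻¹ • (x - a)))
      (hφ.continuous.comp (by fun_prop)) (hc.comp_scale hρ a)
  · refine Continuous.aestronglyMeasurable (continuous_const.mul ?_)
    exact hcont.comp (by fun_prop : Continuous fun p : Euc n × Gr n k => ρ⁻¹ • (p.1 - a))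
  · refine Eventually.of_forall fun p r hr => ?_
    have hr0 : 0 < r := (by linarith : (0:ℝ) < ρ / 2).trans hr
    rw [norm_mul, norm_neg, norm_inv, Real.norm_of_nonneg hr0.le]
    exact mul_le_mul (inv_anti₀ (by linarith) (le_of_lt hr)) (hC _) (norm_nonneg _) (by positivity)
  · exact integrable_const _
  · refine Eventually.of_forall fun p r hr => ?_
    have hr0 : 0 < r := (by linarith : (0:ℝ) < ρ / 2).trans hr
    have h1 : HasDerivAt (fun r : ℝ => r⁻¹ • (p.1 - a)) ((-(r ^ 2)⁻¹) • (p.1 - a)) r :=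
      (hasDerivAt_inv hr0.ne').smul_const _
    have h2 := (hφ.differentiable (by simp) (r⁻¹ • (p.1 - a))).hasFDerivAt.comp_hasDerivAt r h1
    refine h2.congr_deriv ?_
    simp only [map_smul, smul_eq_mul]
    field_simp

/-- The derivative of the scale invariant integral `ρ⁻ᵏ ∫ φ((x - a) / ρ) dV`. For a stationary
varifold it only involves the components of `x - a` normal to the planes. -/
theorem StationaryIn.hasDerivAt_scale {V : Measure (Euc n × Gr n k)} [IsFiniteMeasure V]
    {U : Set (Euc n)} (hV : StationaryIn V U) {φ : Euc n → ℝ} (hφ : ContDiff ℝ ∞ φ)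
    (hc : HasCompactSupport φ) (a : Euc n) {ρ : ℝ} (hρ : 0 < ρ)
    (hs : tsupport (fun x => φ (ρ⁻¹ • (x - a))) ⊆ U) :
    HasDerivAt (fun ρ : ℝ => (ρ ^ k)⁻¹ * ∫ p, φ (ρ⁻¹ • (p.1 - a)) ∂V)
      (-((ρ ^ (k + 1))⁻¹ * ∫ p, fderiv ℝ φ (ρ⁻¹ • (p.1 - a))
        (ρ⁻¹ • (p.1 - a) - p.2.proj (ρ⁻¹ • (p.1 - a))) ∂V)) ρ := by
  have h1 := hasDerivAt_integral_scale (V := V) hφ hc a hρ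
  have h2 : HasDerivAt (fun ρ : ℝ => (ρ ^ k)⁻¹) (-(k * ρ ^ (k - 1)) / (ρ ^ k) ^ 2) ρ :=
    (hasDerivAt_pow k ρ).inv (pow_pos hρ k).ne'
  have h3 := h2.mul h1
  have hrad := hV.integral_radial (φ := fun x => φ (ρ⁻¹ • (x - a)))
    (hφ.comp (by fun_prop)) (hc.comp_scale hρ a) hs a
  have hi1 : Integrable (fun p : Euc n × Gr n k => φ (ρ⁻¹ • (p.1 - a))) V :=
    integrable_of_hasCompactSupport_fst (φ := fun x => φ (ρ⁻¹ • (x - a)))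
      (hφ.continuous.comp (by fun_prop)) (hc.comp_scale hρ a)
  have hfd : Continuous (fderiv ℝ φ) := hφ.continuous_fderiv (by simp)
  have hproj : Continuous fun p : Euc n × Gr n k => p.2.proj (ρ⁻¹ • (p.1 - a)) :=
    (Gr.continuous_proj.comp continuous_snd).clm_apply (by fun_prop)
  have hcomp : HasCompactSupport (fun y : Euc n => ‖fderiv ℝ φ y‖ * ‖y‖) :=
    (hc.fderiv ℝ).norm.mul_right
  obtain ⟨D, hD⟩ := (hfd.norm.mul continuous_norm).bounded_above_of_compact_support hcomp
  have hi2 : Integrable (fun p : Euc n × Gr n k =>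
      fderiv ℝ φ (ρ⁻¹ • (p.1 - a)) (ρ⁻¹ • (p.1 - a))) V :=
    integrable_of_hasCompactSupport_fst (φ := fun x => fderiv ℝ φ (ρ⁻¹ • (x - a)) (ρ⁻¹ • (x - a)))
      ((continuous_fderiv_apply_self hφ).comp (by fun_prop))
      ((hasCompactSupport_fderiv_apply_self hc).comp_scale hρ a)
  have hi3 : Integrable (fun p : Euc n × Gr n k =>
      fderiv ℝ φ (ρ⁻¹ • (p.1 - a)) (p.2.proj (ρ⁻¹ • (p.1 - a)))) V := by
    refine Integrable.of_bound (Continuous.aestronglyMeasurable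
      ((hfd.comp (by fun_prop)).clm_apply hproj)) D (Eventually.of_forall fun p => ?_)
    refine (ContinuousLinearMap.le_opNorm _ _).trans ((mul_le_mul_of_nonneg_left
      ((p.2.proj.le_opNorm _).trans (mul_le_of_le_one_left (norm_nonneg _) p.2.norm_proj_le))
      (norm_nonneg _)).trans ?_)
    exact (le_abs_self _).trans (hD _)
  have hrad' : k * ∫ p, φ (ρ⁻¹ • (p.1 - a)) ∂V +
      ∫ p, fderiv ℝ φ (ρ⁻¹ • (p.1 - a)) (p.2.proj (ρ⁻¹ • (p.1 - a))) ∂V = 0 := by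
    rw [← integral_const_mul, ← integral_add (hi1.const_mul _) hi3, ← hrad]
    refine integral_congr_ae (Eventually.of_forall fun p => ?_)
    simp only
    rw [fderiv_comp_scale hφ, map_smul]
  refine h3.congr_deriv ?_
  simp only [map_sub]
  rw [integral_sub hi2 hi3, integral_const_mul]
  have h5 : ∫ p, fderiv ℝ φ (ρ⁻¹ • (p.1 - a)) (p.2.proj (ρ⁻¹ • (p.1 - a))) ∂V =
    - (k * ∫ p, φ (ρ⁻¹ • (p.1 - a)) ∂V) := by linarith
  rw [h5]
  rcases k with _ | k
  · simp
  · simp only [Nat.cast_add, Nat.cast_one, Nat.add_sub_cancel]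
    field_simp
    ring

/-- A radial function `g(‖y‖²)`, with `g` vanishing beyond `1`, lives in the unit ball. -/
theorem radial_scale_support {g : ℝ → ℝ} (hg : ∀ t, 1 ≤ t → g t = 0) (a : Euc n) {ρ : ℝ}
    (hρ : 0 < ρ) :
    Function.support (fun x : Euc n => g (‖ρ⁻¹ • (x - a)‖ ^ 2)) ⊆ ball a ρ := by
  intro x hx
  by_contra h
  refine hx (hg _ ?_)
  rw [mem_ball, not_lt, dist_eq_norm] at h
  rw [norm_smul, norm_inv, Real.norm_of_nonneg hρ.le]
  have : 1 ≤ ρ⁻¹ * ‖x - a‖ := by rw [inv_mul_eq_div, one_le_div hρ]; exact h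
  exact one_le_pow₀ this

theorem radial_hasCompactSupport {g : ℝ → ℝ} (hg : ∀ t, 1 ≤ t → g t = 0) :
    HasCompactSupport (fun y : Euc n => g (‖y‖ ^ 2)) := by
  refine HasCompactSupport.of_support_subset_isCompact (isCompact_closedBall (0 : Euc n) 1) ?_
  have h := radial_scale_support hg (0 : Euc n) one_pos
  simp only [inv_one, sub_zero, one_smul] at h
  exact h.trans ball_subset_closedBall

theorem radial_fderiv {g : ℝ → ℝ} (hg : ContDiff ℝ ∞ g) (y w : Euc n) :
    fderiv ℝ (fun y : Euc n => g (‖y‖ ^ 2)) y w = deriv g (‖y‖ ^ 2) * (2 * inner ℝ y w) := by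
  have h1 : HasFDerivAt (fun y : Euc n => ‖y‖ ^ 2) (2 • innerSL ℝ y) y :=
    (hasStrictFDerivAt_norm_sq y).hasFDerivAt
  have h2 := ((hg.differentiable (by simp) (‖y‖ ^ 2)).hasDerivAt).comp_hasFDerivAt y h1
  have h3 := h2.fderiv
  simp only [Function.comp_def] at h3
  rw [h3]
  simp

theorem inner_self_sub_proj (S : Gr n k) (y : Euc n) :
    inner ℝ y (y - S.proj y) = ‖y - S.proj y‖ ^ 2 := by
  have h : inner ℝ (S.proj y) (y - S.proj y) = 0 :=
    Submodule.inner_right_of_mem_orthogonal (K := S.1) (Submodule.starProjection_apply_mem _ y)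
      (Submodule.sub_starProjection_mem_orthogonal y)
  rw [← real_inner_self_eq_norm_sq, inner_sub_left (y) (S.proj y), h, sub_zero]

/-- The derivative in the monotonicity formula. -/
theorem StationaryIn.hasDerivAt_radial {V : Measure (Euc n × Gr n k)} [IsFiniteMeasure V]
    {U : Set (Euc n)} (hV : StationaryIn V U) {g : ℝ → ℝ} (hg : ContDiff ℝ ∞ g)
    (hg1 : ∀ t, 1 ≤ t → g t = 0) (a : Euc n) {ρ : ℝ} (hρ : 0 < ρ) (hs : closedBall a ρ ⊆ U) :
    HasDerivAt (fun ρ : ℝ => (ρ ^ k)⁻¹ * ∫ p, g (‖ρ⁻¹ • (p.1 - a)‖ ^ 2) ∂V)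
      ((ρ ^ (k + 1))⁻¹ * ∫ p, -deriv g (‖ρ⁻¹ • (p.1 - a)‖ ^ 2) *
        (2 * ‖ρ⁻¹ • (p.1 - a) - p.2.proj (ρ⁻¹ • (p.1 - a))‖ ^ 2) ∂V) ρ := by
  have h := hV.hasDerivAt_scale (φ := fun y : Euc n => g (‖y‖ ^ 2))
    (hg.comp (contDiff_norm_sq ℝ)) (radial_hasCompactSupport hg1) a hρ
    ((closure_minimal ((radial_scale_support hg1 a hρ).trans ball_subset_closedBall)
      isClosed_closedBall).trans hs)
  convert h using 1
  rw [← mul_neg, ← integral_neg]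
  congr 1
  refine integral_congr_ae (Eventually.of_forall fun p => ?_)
  simp only
  rw [radial_fderiv hg, inner_self_sub_proj]
  ring

/-- A smooth antitone cutoff equal to `1` up to `s` and to `0` from `1` on. -/
theorem exists_cutoff {s : ℝ} (hs : s < 1) : ∃ g : ℝ → ℝ, ContDiff ℝ ∞ g ∧ Antitone g ∧
    (∀ t, t ≤ s → g t = 1) ∧ (∀ t, 1 ≤ t → g t = 0) ∧ (∀ t, 0 ≤ g t ∧ g t ≤ 1) := by
  have h1 : 0 < 1 - s := by linarith
  refine ⟨fun t => Real.smoothTransition ((1 - t) / (1 - s)), ?_, ?_, ?_, ?_, ?_⟩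
  · exact Real.smoothTransition.contDiff.comp (by fun_prop)
  · intro t u htu
    exact Real.smoothTransition.monotone (by gcongr)
  · intro t ht
    exact Real.smoothTransition.one_of_one_le ((one_le_div h1).2 (by linarith))
  · intro t ht
    exact Real.smoothTransition.zero_of_nonpos (div_nonpos_of_nonpos_of_nonneg (by linarith) h1.le)
  · exact fun t => ⟨Real.smoothTransition.nonneg _, Real.smoothTransition.le_one _⟩

/-- The monotonicity formula for a smooth radial weight. -/
theorem StationaryIn.monotoneOn_radial {V : Measure (Euc n × Gr n k)} [IsFiniteMeasure V]
    {U : Set (Euc n)} (hV : StationaryIn V U) {g : ℝ → ℝ} (hg : ContDiff ℝ ∞ g) (hga : Antitone g)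
    (hg1 : ∀ t, 1 ≤ t → g t = 0) {a : Euc n} {R : ℝ} (hs : ball a R ⊆ U) :
    MonotoneOn (fun ρ : ℝ => (ρ ^ k)⁻¹ * ∫ p, g (‖ρ⁻¹ • (p.1 - a)‖ ^ 2) ∂V) (Ioo 0 R) := by
  have hd : ∀ ρ ∈ Ioo 0 R, _ := fun ρ hρ => hV.hasDerivAt_radial hg hg1 a hρ.1
    ((closedBall_subset_ball hρ.2).trans hs)
  refine monotoneOn_of_deriv_nonneg (convex_Ioo 0 R)
    (fun ρ hρ => (hd ρ hρ).continuousAt.continuousWithinAt) ?_ ?_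
  · rw [interior_Ioo]
    exact fun ρ hρ => (hd ρ hρ).differentiableAt.differentiableWithinAt
  · rw [interior_Ioo]
    intro ρ hρ
    rw [(hd ρ hρ).deriv]
    refine mul_nonneg (by have := hρ.1; positivity) (integral_nonneg fun p => ?_)
    exact mul_nonneg (neg_nonneg.2 hga.deriv_nonpos) (by positivity)

/-- The density ratio `r⁻ᵏ ‖V‖(B_r(a))`. -/
def densityRatio (V : Measure (Euc n × Gr n k)) (a : Euc n) (r : ℝ) : ℝ :=
  (r ^ k)⁻¹ * V.fst.real (ball a r)

theorem integral_indicator_ball_fst (V : Measure (Euc n × Gr n k)) (a : Euc n) (r : ℝ) :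
    ∫ p, (ball a r).indicator (fun _ => (1 : ℝ)) p.1 ∂V = V.fst.real (ball a r) := by
  have h : (fun p : Euc n × Gr n k => (ball a r).indicator (fun _ => (1 : ℝ)) p.1) =
      (Prod.fst ⁻¹' ball a r).indicator 1 := by
    ext p; simp [indicator]
  rw [h, integral_indicator_one (measurable_fst measurableSet_ball), measureReal_def,
    measureReal_def, Measure.fst_apply measurableSet_ball]

theorem integrable_indicator_ball_fst (W : Measure (Euc n × Gr n k)) [IsFiniteMeasure W]
    (a : Euc n) (r : ℝ) :
    Integrable (fun p : Euc n × Gr n k => (ball a r).indicator (fun _ => (1 : ℝ)) p.1) W := by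
  refine Integrable.of_bound (Measurable.aestronglyMeasurable
    ((measurable_const.indicator measurableSet_ball).comp measurable_fst)) 1
    (Eventually.of_forall fun p => ?_)
  simp only [indicator]; split_ifs <;> simp

/-- **Monotonicity** of the density ratios of a stationary varifold. -/
theorem StationaryIn.densityRatio_mono {V : Measure (Euc n × Gr n k)} [IsFiniteMeasure V]
    {U : Set (Euc n)} (hV : StationaryIn V U) {a : Euc n} {s t R : ℝ} (hs0 : 0 < s) (hst : s ≤ t)
    (htR : t < R) (hs : ball a R ⊆ U) : densityRatio V a s ≤ densityRatio V a t := by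
  rcases hst.eq_or_lt with rfl | hst
  · exact le_rfl
  have ht0 : 0 < t := hs0.trans hst
  -- For `q < 1` near `1`, compare with a cutoff at scale `s / q` which is `1` on `B_s`.
  have key : ∀ q ∈ Ioo (s / t) 1, q ^ k * densityRatio V a s ≤ densityRatio V a t := by
    intro q hq
    have hq0 : 0 < q := (div_pos hs0 ht0).trans hq.1
    have hsq : s / q < t := by
      rw [div_lt_iff₀ hq0]; have := hq.1; rw [div_lt_iff₀ ht0] at this; linarith
    obtain ⟨g, hg, hga, hgs, hg1, hg01⟩ := exists_cutoff (s := q ^ 2)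
      (pow_lt_one₀ hq0.le hq.2 two_ne_zero)
    have hint : ∀ ρ : ℝ, 0 < ρ →
        Integrable (fun p : Euc n × Gr n k => g (‖ρ⁻¹ • (p.1 - a)‖ ^ 2)) V := fun ρ hρ => by
      refine Integrable.of_bound (Continuous.aestronglyMeasurable
        (hg.continuous.comp (by fun_prop))) 1 (Eventually.of_forall fun p => ?_)
      rw [Real.norm_of_nonneg (hg01 _).1]; exact (hg01 _).2
    have hm := hV.monotoneOn_radial hg hga hg1 hs ⟨div_pos hs0 hq0, hsq.trans htR⟩ ⟨ht0, htR⟩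
      hsq.le
    have hlow : V.fst.real (ball a s) ≤ ∫ p, g (‖(s / q)⁻¹ • (p.1 - a)‖ ^ 2) ∂V := by
      rw [← integral_indicator_ball_fst]
      refine integral_mono (integrable_indicator_ball_fst V a s) (hint _ (div_pos hs0 hq0))
        fun p => ?_
      simp only [indicator]
      split_ifs with h
      · refine (hgs _ ?_).ge
        rw [norm_smul, norm_inv, Real.norm_of_nonneg (div_pos hs0 hq0).le]
        refine pow_le_pow_left₀ (by positivity) ?_ 2
        rw [mem_ball, dist_eq_norm] at h
        rw [inv_div, div_mul_eq_mul_div, div_le_iff₀ hs0]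
        gcongr
      · exact (hg01 _).1
    have hup : ∫ p, g (‖t⁻¹ • (p.1 - a)‖ ^ 2) ∂V ≤ V.fst.real (ball a t) := by
      rw [← integral_indicator_ball_fst]
      refine integral_mono (hint t ht0) (integrable_indicator_ball_fst V a t) fun p => ?_
      simp only [indicator]
      split_ifs with h
      · exact (hg01 _).2
      · refine le_of_eq (by_contra fun h' => h (radial_scale_support hg1 a ht0 h'))
    calc q ^ k * densityRatio V a s = ((s / q) ^ k)⁻¹ * V.fst.real (ball a s) := by
          rw [densityRatio, div_pow]; field_simp
      _ ≤ ((s / q) ^ k)⁻¹ * ∫ p, g (‖(s / q)⁻¹ • (p.1 - a)‖ ^ 2) ∂V := by gcongr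
      _ ≤ (t ^ k)⁻¹ * ∫ p, g (‖t⁻¹ • (p.1 - a)‖ ^ 2) ∂V := hm
      _ ≤ densityRatio V a t := by rw [densityRatio]; gcongr
  have hlim : Tendsto (fun q : ℝ => q ^ k * densityRatio V a s) (𝓝[<] 1)
      (𝓝 (densityRatio V a s)) := by
    have : Tendsto (fun q : ℝ => q ^ k * densityRatio V a s) (𝓝 1)
        (𝓝 (1 ^ k * densityRatio V a s)) :=
      (Continuous.tendsto (by fun_prop) 1)
    rw [one_pow, one_mul] at this
    exact this.mono_left nhdsWithin_le_nhds
  exact le_of_tendsto hlim (eventually_of_mem (Ioo_mem_nhdsLT ((div_lt_one ht0).2 hst)) key)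

end FirstVariation

/-! ### Limits of measures along ultrafilters -/

section Compactness

/-- Measures of bounded mass on a locally compact space have a weak* limit along every
ultrafilter. -/
theorem exists_ultrafilter_limit {X ι : Type*} [TopologicalSpace X] [T2Space X]
    [LocallyCompactSpace X] [MeasurableSpace X] [BorelSpace X] (𝒰 : Ultrafilter ι)
    (M : ι → Measure X) [∀ i, IsFiniteMeasure (M i)] {C : ℝ} (hC : ∀ i, (M i).real univ ≤ C) :
    ∃ V : Measure X, IsFiniteMeasure V ∧ ∀ φ : X → ℝ, Continuous φ → HasCompactSupport φ →
      Tendsto (fun i => ∫ x, φ x ∂M i) 𝒰 (𝓝 (∫ x, φ x ∂V)) := by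
  have hint : ∀ (φ : CompactlySupportedContinuousMap X ℝ) i, Integrable φ (M i) := fun φ i =>
    φ.continuous.integrable_of_hasCompactSupport φ.hasCompactSupport
  have hlim : ∀ φ : CompactlySupportedContinuousMap X ℝ,
      ∃ l, Tendsto (fun i => ∫ x, φ x ∂M i) 𝒰 (𝓝 l) := by
    intro φ
    obtain ⟨B, hB⟩ := φ.continuous.bounded_above_of_compact_support φ.hasCompactSupport
    have hmem : ∀ i, ∫ x, φ x ∂M i ∈ closedBall (0 : ℝ) (|B| * C) := fun i => by
      rw [mem_closedBall_zero_iff]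
      refine (norm_integral_le_of_norm_le_const (C := |B|)
        (Eventually.of_forall fun x => (hB x).trans (le_abs_self B))).trans ?_
      exact mul_le_mul_of_nonneg_left (hC i) (abs_nonneg B)
    obtain ⟨l, -, hl⟩ := (isCompact_closedBall (0 : ℝ) (|B| * C)).ultrafilter_le_nhds
      (𝒰.map fun i => ∫ x, φ x ∂M i)
      (le_principal_iff.2 (Filter.mem_map.2 (univ_mem' hmem)))
    exact ⟨l, hl⟩
  choose l hl using hlim
  let Λ₀ : CompactlySupportedContinuousMap X ℝ →ₗ[ℝ] ℝ :=
    { toFun := l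
      map_add' := fun φ ψ => by
        refine tendsto_nhds_unique (hl _) (((hl φ).add (hl ψ)).congr fun i => ?_)
        exact (integral_add (hint φ i) (hint ψ i)).symm
      map_smul' := fun c φ => by
        refine tendsto_nhds_unique (hl _) (((hl φ).const_mul c).congr fun i => ?_)
        exact (integral_const_mul c _).symm }
  let Λ : CompactlySupportedContinuousMap X ℝ →ₚ[ℝ] ℝ := PositiveLinearMap.mk₀ Λ₀ fun φ hφ =>
    ge_of_tendsto (hl φ) (Eventually.of_forall fun i => integral_nonneg hφ)
  have hΛ : ∀ φ, Λ φ = l φ := fun _ => rfl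
  refine ⟨RealRMK.rieszMeasure Λ, ⟨?_⟩, fun φ hφ hc => ?_⟩
  · refine lt_of_le_of_lt (b := ENNReal.ofReal C) ?_ ENNReal.ofReal_lt_top
    rw [isOpen_univ.measure_eq_iSup_isCompact]
    refine iSup₂_le fun K _ => iSup_le fun hK => ?_
    obtain ⟨f, hf1, -, hfc, hf01⟩ := exists_continuous_one_zero_of_isCompact hK
      (isClosed_empty (X := X)) (disjoint_empty K)
    refine (RealRMK.rieszMeasure_le_of_eq_one Λ (f := ⟨f, hfc⟩) (fun x => (hf01 x).1) hK
      fun x hx => hf1 hx).trans (ENNReal.ofReal_le_ofReal ?_)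
    rw [hΛ]
    refine le_of_tendsto (hl _) (Eventually.of_forall fun i => ?_)
    refine (integral_mono (hint _ i) (integrable_const 1) fun x => (hf01 x).2).trans ?_
    simpa using hC i
  · have h := RealRMK.integral_rieszMeasure Λ ⟨⟨φ, hφ⟩, hc⟩
    rw [hΛ] at h
    have h2 := hl ⟨⟨φ, hφ⟩, hc⟩
    rw [← h] at h2
    exact h2

variable {n k : ℕ}

theorem hasCompactSupport_comp_fst {E : Type*} [Zero E] {φ : Euc n → E}
    (hc : HasCompactSupport φ) :
    HasCompactSupport (fun p : Euc n × Gr n k => φ p.1) := by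
  refine HasCompactSupport.of_support_subset_isCompact
    (hc.isCompact.prod (isCompact_univ (X := Gr n k))) fun p hp =>
      ⟨subset_tsupport φ hp, mem_univ _⟩

variable {ι : Type*} {𝒰 : Ultrafilter ι} {M : ι → Measure (Euc n × Gr n k)}
  {V : Measure (Euc n × Gr n k)}

/-- `V` is the weak* limit of the measures `M i` along the ultrafilter `𝒰`. -/
def WeakLimit (𝒰 : Ultrafilter ι) (M : ι → Measure (Euc n × Gr n k))
    (V : Measure (Euc n × Gr n k)) : Prop :=
  ∀ φ : Euc n × Gr n k → ℝ, Continuous φ → HasCompactSupport φ →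
    Tendsto (fun i => ∫ x, φ x ∂M i) 𝒰 (𝓝 (∫ x, φ x ∂V))

theorem WeakLimit.stationaryIn (h : WeakLimit 𝒰 M V) {U : Set (Euc n)}
    (hM : ∀ i, StationaryIn (M i) U) : StationaryIn V U := by
  intro X hX hc hs
  have hcont : Continuous fun p : Euc n × Gr n k => LinearMap.trace ℝ (Euc n)
      (p.2.proj ∘L fderiv ℝ X p.1 : Euc n →L[ℝ] Euc n).toLinearMap :=
    continuous_trace_clm.comp ((Gr.continuous_proj.comp continuous_snd).clm_comp
      ((hX.continuous_fderiv (by simp)).comp continuous_fst))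
  have hcs : HasCompactSupport fun p : Euc n × Gr n k => LinearMap.trace ℝ (Euc n)
      (p.2.proj ∘L fderiv ℝ X p.1 : Euc n →L[ℝ] Euc n).toLinearMap := by
    refine (hasCompactSupport_comp_fst (k := k) (hc.fderiv ℝ)).mono fun p hp hz => hp ?_
    simp only at hz ⊢
    rw [hz]
    simp
  exact tendsto_nhds_unique ((h _ hcont hcs).congr fun i => hM i X hX hc hs) tendsto_const_nhds

variable [∀ i, IsFiniteMeasure (M i)] [IsFiniteMeasure V]

theorem exists_ball_cutoff (a : Euc n) {s t : ℝ} (hst : s < t) : ∃ φ : Euc n → ℝ,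
    Continuous φ ∧ HasCompactSupport φ ∧ (∀ x, (ball a s).indicator (fun _ => (1 : ℝ)) x ≤ φ x) ∧
    ∀ x, φ x ≤ (ball a t).indicator (fun _ => (1 : ℝ)) x := by
  have h0 : 0 < t - s := by linarith
  have hz : ∀ x, t ≤ dist x a → max 0 (min 1 ((t - dist x a) / (t - s))) = 0 := fun x hx =>
    max_eq_left ((min_le_right _ _).trans (div_nonpos_of_nonpos_of_nonneg (by linarith) h0.le))
  refine ⟨fun x => max 0 (min 1 ((t - dist x a) / (t - s))), by fun_prop, ?_, ?_, ?_⟩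
  · refine HasCompactSupport.of_support_subset_isCompact (isCompact_closedBall a t) fun x hx => ?_
    by_contra h
    exact hx (hz x (not_le.1 h).le)
  · intro x
    simp only [indicator]
    split_ifs with h
    · refine le_max_of_le_right (le_min le_rfl ((one_le_div h0).2 ?_))
      rw [mem_ball] at h; linarith
    · exact le_max_left _ _
  · intro x
    simp only [indicator]
    split_ifs with h
    · exact max_le zero_le_one (min_le_left _ _)
    · exact (hz x (not_lt.1 h)).le

theorem WeakLimit.ball_le (h : WeakLimit 𝒰 M V) (a : Euc n) {s t : ℝ} (hst : s < t)
    {c : ι → ℝ} {c₀ : ℝ} (hc : Tendsto c 𝒰 (𝓝 c₀))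
    (hle : ∀ᶠ i in 𝒰, (M i).fst.real (ball a t) ≤ c i) : V.fst.real (ball a s) ≤ c₀ := by
  obtain ⟨φ, hφ, hφc, h1, h2⟩ := exists_ball_cutoff a hst
  refine le_trans ?_ (le_of_tendsto_of_tendsto
    (h _ (hφ.comp continuous_fst) (hasCompactSupport_comp_fst hφc)) hc (hle.mono fun i hi => ?_))
  · rw [← integral_indicator_ball_fst]
    exact integral_mono (integrable_indicator_ball_fst V a s)
      (integrable_of_hasCompactSupport_fst hφ hφc) fun p => h1 p.1
  · refine le_trans ?_ hi
    rw [← integral_indicator_ball_fst]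
    exact integral_mono (integrable_of_hasCompactSupport_fst hφ hφc)
      (integrable_indicator_ball_fst (M i) a t) fun p => h2 p.1

theorem WeakLimit.le_ball (h : WeakLimit 𝒰 M V) (a : Euc n) {s t : ℝ} (hst : s < t)
    {c : ι → ℝ} {c₀ : ℝ} (hc : Tendsto c 𝒰 (𝓝 c₀))
    (hle : ∀ᶠ i in 𝒰, c i ≤ (M i).fst.real (ball a s)) : c₀ ≤ V.fst.real (ball a t) := by
  obtain ⟨φ, hφ, hφc, h1, h2⟩ := exists_ball_cutoff a hst
  refine le_trans (le_of_tendsto_of_tendsto hc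
    (h _ (hφ.comp continuous_fst) (hasCompactSupport_comp_fst hφc))
    (hle.mono fun i hi => hi.trans ?_)) ?_
  · rw [← integral_indicator_ball_fst]
    exact integral_mono (integrable_indicator_ball_fst (M i) a s)
      (integrable_of_hasCompactSupport_fst hφ hφc) fun p => h1 p.1
  · rw [← integral_indicator_ball_fst]
    exact integral_mono (integrable_of_hasCompactSupport_fst hφ hφc)
      (integrable_indicator_ball_fst V a t) fun p => h2 p.1

/-- Lower density bounds pass to the points of the support of a weak* limit. -/
theorem WeakLimit.lower_density (h : WeakLimit 𝒰 M V) {c : ℝ}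
    (hM : ∀ i, ∀ᵐ x ∂(M i).fst, x ∈ ball (0 : Euc n) 2 → ∀ s, 0 < s → s < 2 - ‖x‖ →
      c ≤ densityRatio (M i) x s) :
    ∀ᵐ a ∂V.fst, a ∈ ball (0 : Euc n) 2 →
      ∀ᶠ s in 𝓝[>] (0 : ℝ), c / 4 ^ k ≤ densityRatio V a s := by
  filter_upwards [V.fst.support_mem_ae] with a ha ha2
  rw [mem_ball_zero_iff] at ha2
  have hpos : (0 : ℝ) < 2 - ‖a‖ := by linarith
  filter_upwards [Ioo_mem_nhdsGT hpos] with s hs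
  obtain ⟨ρ, rfl⟩ : ∃ ρ, s = 4 * ρ := ⟨s / 4, by ring⟩
  have hρ : 0 < ρ := by linarith [hs.1]
  have hVpos : 0 < V.fst.real (ball a ρ) := by
    rw [measureReal_def]
    exact ENNReal.toReal_pos ((Measure.mem_support_iff_forall a).1 ha _ (ball_mem_nhds a hρ)).ne'
      (measure_ne_top _ _)
  have hnz : ∀ᶠ i in 𝒰, ¬ (M i).fst.real (ball a (2 * ρ)) ≤ 0 := by
    rw [Ultrafilter.eventually_not]
    intro hev
    exact hVpos.not_ge (h.ball_le a (by linarith : ρ < 2 * ρ) tendsto_const_nhds hev)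
  have hlow : ∀ᶠ i in 𝒰, c * ρ ^ k ≤ (M i).fst.real (ball a (3 * ρ)) := by
    filter_upwards [hnz] with i hi
    have hne : (M i).fst (ball a (2 * ρ)) ≠ 0 := fun h0 => hi (by simp [measureReal_def, h0])
    obtain ⟨x, hx, hxd⟩ := (frequently_ae_mem_iff.2 hne).and_eventually (hM i) |>.exists
    rw [mem_ball, dist_eq_norm] at hx
    have hxa : ‖x‖ ≤ ‖x - a‖ + ‖a‖ := by simpa using norm_add_le (x - a) a
    have hx2 : ‖x‖ < 2 := by linarith [hs.2]
    have h1 := hxd (mem_ball_zero_iff.2 hx2) ρ hρ (by linarith [hs.2])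
    rw [densityRatio, inv_mul_eq_div, le_div_iff₀ (pow_pos hρ k)] at h1
    refine h1.trans (measureReal_mono (ball_subset_ball' ?_))
    rw [dist_eq_norm]; linarith
  have h2 := h.le_ball a (by linarith : 3 * ρ < 4 * ρ) tendsto_const_nhds hlow
  rw [densityRatio, mul_pow, inv_mul_eq_div, div_le_div_iff₀ (by positivity) (by positivity)]
  nlinarith [pow_pos (four_pos (α := ℝ)) k]

end Compactness

/-! ### Constant density ratios and conical weight -/

section ConicalWeight

variable {n k : ℕ}

/-- If the density ratios along the sequence are asymptotically constant on shrinking scales, the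
weak* limit has constant density ratio. -/
theorem WeakLimit.ball_eq {ι : Type*} {𝒰 : Ultrafilter ι} {M : ι → Measure (Euc n × Gr n k)}
    [∀ i, IsFiniteMeasure (M i)] {V : Measure (Euc n × Gr n k)} [IsFiniteMeasure V]
    (h : WeakLimit 𝒰 M V) (hM : ∀ i, StationaryIn (M i) (ball 0 2)) {C : ℝ}
    (hC : ∀ i, (M i).real univ ≤ C) {δ r : ι → ℝ} (hδ : Tendsto δ 𝒰 (𝓝 0))
    (hr : Tendsto r 𝒰 (𝓝 0)) (hr0 : ∀ i, 0 < r i)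
    (hpinch : ∀ i, densityRatio (M i) 0 1 - densityRatio (M i) 0 (r i) ≤ δ i) :
    ∃ L : ℝ, ∀ t ∈ Ioo (0 : ℝ) 1, V.fst.real (ball 0 t) = L * t ^ k := by
  have hmem : ∀ i, densityRatio (M i) 0 1 ∈ Icc 0 C := fun i => by
    simp only [densityRatio, one_pow, inv_one, one_mul]
    refine ⟨measureReal_nonneg, le_trans ?_ (hC i)⟩
    rw [measureReal_def, Measure.fst_apply measurableSet_ball, ← measureReal_def]
    exact measureReal_mono (subset_univ _)
  obtain ⟨L, -, hL⟩ := (isCompact_Icc (a := (0 : ℝ)) (b := C)).ultrafilter_le_nhds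
    (𝒰.map fun i => densityRatio (M i) 0 1) (le_principal_iff.2 (Filter.mem_map.2 (univ_mem' hmem)))
  replace hL : Tendsto (fun i => densityRatio (M i) 0 1) 𝒰 (𝓝 L) := hL
  have hlim : ∀ t ∈ Ioo (0 : ℝ) 1,
      Tendsto (fun i => (M i).fst.real (ball 0 t)) 𝒰 (𝓝 (L * t ^ k)) := by
    intro t ht
    have h1 : Tendsto (fun i => densityRatio (M i) 0 t) 𝒰 (𝓝 L) := by
      refine tendsto_of_tendsto_of_tendsto_of_le_of_le' (by simpa using hL.sub hδ) hL ?_ ?_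
      · filter_upwards [hr.eventually (gt_mem_nhds ht.1)] with i hi
        have := (hM i).densityRatio_mono (hr0 i) hi.le (ht.2.trans one_lt_two) le_rfl
        linarith [hpinch i]
      · exact Eventually.of_forall fun i =>
          (hM i).densityRatio_mono ht.1 ht.2.le one_lt_two le_rfl
    refine (h1.mul_const (t ^ k)).congr fun i => ?_
    have := pow_pos ht.1 k
    rw [densityRatio]; field_simp
  have hcont : ∀ t : ℝ, Tendsto (fun u : ℝ => L * u ^ k) (𝓝 t) (𝓝 (L * t ^ k)) := fun t =>
    Continuous.tendsto (by fun_prop) t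
  refine ⟨L, fun t ht => le_antisymm ?_ ?_⟩
  · refine ge_of_tendsto ((hcont t).mono_left (nhdsWithin_le_nhds (s := Ioi t)))
      (eventually_of_mem (Ioo_mem_nhdsGT ht.2) fun u hu => ?_)
    exact h.ball_le 0 hu.1 (hlim u ⟨ht.1.trans hu.1, hu.2⟩) (Eventually.of_forall fun _ => le_rfl)
  · refine le_of_tendsto ((hcont t).mono_left (nhdsWithin_le_nhds (s := Iio t)))
      (eventually_of_mem (Ioo_mem_nhdsLT ht.1) fun u hu => ?_)
    exact h.le_ball 0 hu.2 (hlim u ⟨hu.1, hu.2.trans ht.2⟩) (Eventually.of_forall fun _ => le_rfl)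

/-- Radial integrals scale like the measure of balls. -/
theorem integral_radial_eq_of_ball_eq {V : Measure (Euc n × Gr n k)} [IsFiniteMeasure V] {L : ℝ}
    (hL : ∀ t ∈ Ioo (0 : ℝ) 1, V.fst.real (ball 0 t) = L * t ^ k) {g : ℝ → ℝ} (hg : Continuous g)
    (hg1 : ∀ t, 1 ≤ t → g t = 0) {ρ σ : ℝ} (hρ : ρ ∈ Ioo (0 : ℝ) 1) (hσ : σ ∈ Ioo (0 : ℝ) 1) :
    (ρ ^ k)⁻¹ * ∫ p, g (‖ρ⁻¹ • (p.1 - 0)‖ ^ 2) ∂V =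
      (σ ^ k)⁻¹ * ∫ p, g (‖σ⁻¹ • (p.1 - 0)‖ ^ 2) ∂V := by
  -- The law of `|x| / ρ` on `B_ρ`, normalised by `ρᵏ`, does not depend on `ρ`.
  let ν : ℝ → Measure ℝ := fun ρ =>
    ENNReal.ofReal ((ρ ^ k)⁻¹) • (V.restrict (Prod.fst ⁻¹' ball 0 ρ)).map (fun p => ‖ρ⁻¹ • p.1‖)
  have hmeas : ∀ ρ : ℝ, Measurable fun p : Euc n × Gr n k => ‖ρ⁻¹ • p.1‖ := fun ρ =>
    Continuous.measurable (by fun_prop)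
  have hIio : ∀ ρ ∈ Ioo (0 : ℝ) 1, ∀ b, ν ρ (Iio b) =
      if b ≤ 0 then 0 else ENNReal.ofReal (L * (min b 1) ^ k) := by
    intro ρ hρ b
    have hset : (fun p : Euc n × Gr n k => ‖ρ⁻¹ • p.1‖) ⁻¹' Iio b ∩ Prod.fst ⁻¹' ball 0 ρ =
        Prod.fst ⁻¹' ball 0 (min b 1 * ρ) := by
      ext p
      simp only [mem_inter_iff, mem_preimage, mem_Iio, mem_ball_zero_iff, norm_smul, norm_inv,
        Real.norm_of_nonneg hρ.1.le]
      rw [inv_mul_lt_iff₀ hρ.1, min_mul_of_nonneg _ _ hρ.1.le, lt_min_iff, one_mul, mul_comm]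
    simp only [ν, Measure.smul_apply, smul_eq_mul]
    rw [Measure.map_apply (hmeas ρ) measurableSet_Iio,
      Measure.restrict_apply (hmeas ρ measurableSet_Iio), hset,
      ← Measure.fst_apply measurableSet_ball]
    split_ifs with hb
    · rw [ball_eq_empty.2 (mul_nonpos_of_nonpos_of_nonneg (min_le_of_left_le hb) hρ.1.le)]
      simp
    · have hm : 0 < min b 1 := lt_min (not_le.1 hb) one_pos
      have h1 := hL (min b 1 * ρ) ⟨mul_pos hm hρ.1, lt_of_le_of_lt
        (mul_le_of_le_one_left hρ.1.le (min_le_right _ _)) hρ.2⟩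
      rw [← ofReal_measureReal, h1, ← ENNReal.ofReal_mul (by have := hρ.1; positivity)]
      congr 1
      have := pow_pos hρ.1 k
      rw [mul_pow]; field_simp
  have hfin : ∀ ρ, IsFiniteMeasure (ν ρ) := fun ρ => by
    have : IsFiniteMeasure ((V.restrict (Prod.fst ⁻¹' ball 0 ρ)).map
        (fun p : Euc n × Gr n k => ‖ρ⁻¹ • p.1‖)) := inferInstance
    exact ⟨by simp only [ν, Measure.smul_apply, smul_eq_mul]
              exact ENNReal.mul_lt_top ENNReal.ofReal_lt_top (measure_lt_top _ _)⟩
  have hν : ν ρ = ν σ := by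
    have := hfin ρ
    refine Measure.ext_of_Ici _ _ fun b => ?_
    have huniv : ∀ τ ∈ Ioo (0 : ℝ) 1, ν τ univ = ENNReal.ofReal (L * 1 ^ k) := by
      intro τ hτ
      have h2 := hIio τ hτ 1
      rw [if_neg (by norm_num), min_self] at h2
      rw [← h2]
      simp only [ν, Measure.smul_apply, smul_eq_mul]
      congr 1
      rw [Measure.map_apply (hmeas τ) MeasurableSet.univ,
        Measure.map_apply (hmeas τ) measurableSet_Iio, preimage_univ, Measure.restrict_apply_univ,
        Measure.restrict_apply (hmeas τ measurableSet_Iio)]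
      congr 1
      ext p
      simp only [mem_inter_iff, mem_preimage, mem_Iio, mem_ball_zero_iff, norm_smul, norm_inv,
        Real.norm_of_nonneg hτ.1.le]
      rw [inv_mul_lt_iff₀ hτ.1, mul_one, and_self]
    have := hfin σ
    rw [← compl_Iio, measure_compl measurableSet_Iio (measure_ne_top _ _),
      measure_compl measurableSet_Iio (measure_ne_top _ _), hIio ρ hρ, hIio σ hσ, huniv ρ hρ,
      huniv σ hσ]
  have hint : ∀ ρ ∈ Ioo (0 : ℝ) 1, (ρ ^ k)⁻¹ * ∫ p, g (‖ρ⁻¹ • (p.1 - 0)‖ ^ 2) ∂V =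
      ∫ u, g (u ^ 2) ∂ν ρ := by
    intro ρ hρ
    simp only [ν]
    rw [integral_smul_measure, ENNReal.toReal_ofReal (by have := hρ.1; positivity), smul_eq_mul,
      integral_map (hmeas ρ).aemeasurable (Continuous.aestronglyMeasurable (by fun_prop))]
    congr 1
    rw [setIntegral_eq_integral_of_forall_compl_eq_zero]
    · simp
    · intro p hp
      by_contra h
      refine hp (radial_scale_support hg1 (0 : Euc n) hρ.1 ?_)
      simpa using h
  rw [hint ρ hρ, hint σ hσ, hν]

/-- A smooth antitone function which vanishes beyond `1` and has negative derivative on `(0, 1)`. -/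
theorem exists_strict_cutoff : ∃ g : ℝ → ℝ, ContDiff ℝ ∞ g ∧ (∀ t, 1 ≤ t → g t = 0) ∧
    (∀ t, deriv g t ≤ 0) ∧ ∀ t ∈ Ioo (0 : ℝ) 1, deriv g t < 0 := by
  let f : ContDiffBump (1 / 2 : ℝ) := ⟨1 / 4, 1 / 2, by norm_num, by norm_num⟩
  have hf : Continuous f := f.continuous
  have hd : ∀ t, HasDerivAt (fun t => -∫ u in (1 : ℝ)..t, f u) (-f t) t := fun t =>
    (intervalIntegral.integral_hasDerivAt_right (hf.intervalIntegrable _ _)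
      hf.stronglyMeasurable.stronglyMeasurableAtFilter hf.continuousAt).neg
  have hderiv : deriv (fun t => -∫ u in (1 : ℝ)..t, f u) = fun t => -f t :=
    funext fun t => (hd t).deriv
  refine ⟨fun t => -∫ u in (1 : ℝ)..t, f u, ?_, ?_, ?_, ?_⟩
  · rw [contDiff_infty_iff_deriv, hderiv]
    exact ⟨fun t => (hd t).differentiableAt, f.contDiff.neg⟩
  · intro t ht
    rw [neg_eq_zero]
    refine intervalIntegral.integral_zero_ae (Eventually.of_forall fun u hu => ?_)
    rw [uIoc_of_le ht] at hu
    refine f.zero_of_le_dist ?_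
    rw [Real.dist_eq, abs_of_nonneg (by linarith [hu.1])]
    change (1 : ℝ) / 2 ≤ _
    linarith [hu.1]
  · intro t; rw [hderiv]; exact neg_nonpos.2 f.nonneg
  · intro t ht
    rw [hderiv]
    refine neg_neg_of_pos (f.pos_of_mem_ball ?_)
    rw [mem_ball, Real.dist_eq, abs_lt]
    change -((1 : ℝ) / 2) < _ ∧ _ < (1 : ℝ) / 2
    constructor <;> linarith [ht.1, ht.2]

/-- A stationary varifold with constant density ratio at `0` is radial: almost every plane contains
its base point. -/
theorem StationaryIn.ae_mem_plane {V : Measure (Euc n × Gr n k)} [IsFiniteMeasure V]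
    (hV : StationaryIn V (ball 0 2)) {L : ℝ}
    (hL : ∀ t ∈ Ioo (0 : ℝ) 1, V.fst.real (ball 0 t) = L * t ^ k) :
    ∀ᵐ p ∂V, p.1 ∈ ball (0 : Euc n) 1 → p.2.proj p.1 = p.1 := by
  obtain ⟨g, hg, hg1, hgd, hgd'⟩ := exists_strict_cutoff
  have hdc : Continuous (deriv g) := hg.continuous_deriv (by simp)
  have key : ∀ ρ ∈ Ioo (0 : ℝ) 1,
      ∀ᵐ p ∂V, p.1 ∈ ball (0 : Euc n) ρ → p.2.proj p.1 = p.1 := by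
    intro ρ hρ
    have h1 := hV.hasDerivAt_radial hg hg1 0 hρ.1
      ((closedBall_subset_ball hρ.2).trans (ball_subset_ball one_le_two))
    have h2 : HasDerivAt (fun ρ : ℝ => (ρ ^ k)⁻¹ * ∫ p, g (‖ρ⁻¹ • (p.1 - 0)‖ ^ 2) ∂V) 0 ρ :=
      (hasDerivAt_const ρ ((ρ ^ k)⁻¹ * ∫ p, g (‖ρ⁻¹ • (p.1 - 0)‖ ^ 2) ∂V)).congr_of_eventuallyEq
        (eventually_of_mem (Ioo_mem_nhds hρ.1 hρ.2) fun σ hσ =>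
          integral_radial_eq_of_ball_eq hL hg.continuous hg1 hσ hρ)
    have h3 := (mul_eq_zero.1 (h1.unique h2)).resolve_left
      (inv_ne_zero (pow_pos hρ.1 _).ne')
    have hcont : Continuous fun p : Euc n × Gr n k => -deriv g (‖ρ⁻¹ • (p.1 - 0)‖ ^ 2) *
        (2 * ‖ρ⁻¹ • (p.1 - 0) - p.2.proj (ρ⁻¹ • (p.1 - 0))‖ ^ 2) := by
      have h4 : Continuous fun p : Euc n × Gr n k => p.2.proj (ρ⁻¹ • (p.1 - 0)) :=
        (Gr.continuous_proj.comp continuous_snd).clm_apply (by fun_prop)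
      fun_prop
    have hcs : HasCompactSupport fun p : Euc n × Gr n k => -deriv g (‖ρ⁻¹ • (p.1 - 0)‖ ^ 2) *
        (2 * ‖ρ⁻¹ • (p.1 - 0) - p.2.proj (ρ⁻¹ • (p.1 - 0))‖ ^ 2) := by
      refine HasCompactSupport.mul_right ?_
      have hd1 : ∀ t, 1 < t → deriv g t = 0 := fun t ht => by
        have : g =ᶠ[𝓝 t] fun _ => 0 :=
          eventually_of_mem (Ioi_mem_nhds ht) fun u hu => hg1 u (le_of_lt hu)
        rw [this.deriv_eq]; simp
      refine hasCompactSupport_comp_fst (φ := fun x : Euc n => -deriv g (‖ρ⁻¹ • (x - 0)‖ ^ 2)) ?_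
      refine HasCompactSupport.of_support_subset_isCompact (isCompact_closedBall (0 : Euc n) ρ)
        fun x hx => ?_
      by_contra h
      rw [mem_closedBall_zero_iff, not_le] at h
      refine hx ?_
      simp only
      rw [hd1, neg_zero]
      rw [sub_zero, norm_smul, norm_inv, Real.norm_of_nonneg hρ.1.le]
      exact one_lt_pow₀ (by rw [inv_mul_eq_div, one_lt_div hρ.1]; exact h) two_ne_zero
    have h5 := (integral_eq_zero_iff_of_nonneg
      (fun p => mul_nonneg (neg_nonneg.2 (hgd _)) (by positivity))
      (hcont.integrable_of_hasCompactSupport hcs)).1 h3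
    filter_upwards [h5] with p hp hpρ
    by_cases h0 : p.1 = 0
    · rw [h0, map_zero]
    rw [mem_ball_zero_iff] at hpρ
    have hn : ‖ρ⁻¹ • (p.1 - 0)‖ = ‖p.1‖ / ρ := by
      rw [sub_zero, norm_smul, norm_inv, Real.norm_of_nonneg hρ.1.le, inv_mul_eq_div]
    have hpos : 0 < ‖p.1‖ / ρ := div_pos (norm_pos_iff.2 h0) hρ.1
    have h6 := hgd' (‖ρ⁻¹ • (p.1 - 0)‖ ^ 2) (by
      rw [hn]
      exact ⟨by positivity, pow_lt_one₀ hpos.le ((div_lt_one hρ.1).2 hpρ) two_ne_zero⟩)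
    have h7 := (mul_eq_zero.1 hp).resolve_left (neg_ne_zero.2 h6.ne)
    have h8 : ρ⁻¹ • p.1 - p.2.proj (ρ⁻¹ • p.1) = 0 := by simpa using h7
    rw [map_smul, ← smul_sub] at h8
    exact (sub_eq_zero.1 ((smul_eq_zero.1 h8).resolve_left (inv_ne_zero hρ.1.ne'))).symm
  have hseq : ∀ᵐ p ∂V, ∀ m : ℕ, p.1 ∈ ball (0 : Euc n) (1 - 1 / ((m : ℝ) + 2)) →
      p.2.proj p.1 = p.1 := by
    rw [ae_all_iff]
    intro m
    refine key _ ⟨?_, ?_⟩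
    · have : (1 : ℝ) / ((m : ℝ) + 2) < 1 := by
        rw [div_lt_one (by positivity)]; linarith [(Nat.cast_nonneg m : (0 : ℝ) ≤ m)]
      linarith
    · have : (0 : ℝ) < 1 / ((m : ℝ) + 2) := by positivity
      linarith
  filter_upwards [hseq] with p hp hp1
  rw [mem_ball_zero_iff] at hp1
  obtain ⟨m, hm⟩ := exists_nat_one_div_lt (sub_pos.2 hp1)
  refine hp m (mem_ball_zero_iff.2 ?_)
  have : (1 : ℝ) / ((m : ℝ) + 2) ≤ 1 / ((m : ℝ) + 1) := by gcongr; linarith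
  linarith

/-- Scaling of integrals of smooth functions with respect to a radial stationary varifold. -/
theorem StationaryIn.integral_scale_eq {V : Measure (Euc n × Gr n k)} [IsFiniteMeasure V]
    (hV : StationaryIn V (ball 0 2))
    (hrad : ∀ᵐ p ∂V, p.1 ∈ ball (0 : Euc n) 1 → p.2.proj p.1 = p.1) {φ : Euc n → ℝ}
    (hφ : ContDiff ℝ ∞ φ) (hc : HasCompactSupport φ) (hs : tsupport φ ⊆ ball 0 1) {c : ℝ}
    (hc0 : 0 < c) (hc1 : c ≤ 1) :
    ∫ p, φ (c⁻¹ • p.1) ∂V = c ^ k * ∫ p, φ p.1 ∂V := by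
  have hd : ∀ ρ ∈ Icc c 1,
      HasDerivAt (fun ρ : ℝ => (ρ ^ k)⁻¹ * ∫ p, φ (ρ⁻¹ • (p.1 - 0)) ∂V) 0 ρ := by
    intro ρ hρ
    have hρ0 : 0 < ρ := hc0.trans_le hρ.1
    have hsupp : tsupport (fun x => φ (ρ⁻¹ • (x - 0))) ⊆ ball 0 2 := by
      refine (closure_minimal (t := closedBall 0 1) (fun x hx => ?_) isClosed_closedBall).trans
        (closedBall_subset_ball one_lt_two)
      have h1 := hs (subset_tsupport φ hx)
      rw [mem_ball_zero_iff, sub_zero, norm_smul, norm_inv, Real.norm_of_nonneg hρ0.le,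
        inv_mul_lt_iff₀ hρ0] at h1
      rw [mem_closedBall_zero_iff]; linarith [hρ.2]
    refine (hV.hasDerivAt_scale hφ hc 0 hρ0 hsupp).congr_deriv ?_
    rw [neg_eq_zero, mul_eq_zero]
    refine Or.inr (integral_eq_zero_of_ae ?_)
    filter_upwards [hrad] with p hp
    simp only [Pi.zero_apply, sub_zero]
    by_cases h1 : p.1 ∈ ball (0 : Euc n) 1
    · rw [map_smul, hp h1, sub_self, map_zero]
    · have h2 : ρ⁻¹ • p.1 ∉ tsupport φ := fun h => by
        have h3 := hs h
        rw [mem_ball_zero_iff, norm_smul, norm_inv, Real.norm_of_nonneg hρ0.le,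
          inv_mul_lt_iff₀ hρ0, mul_one] at h3
        exact h1 (mem_ball_zero_iff.2 (h3.trans_le hρ.2))
      rw [fderiv_of_notMem_tsupport ℝ h2]; simp
  have h := constant_of_has_deriv_right_zero
    (fun ρ hρ => (hd ρ hρ).continuousAt.continuousWithinAt)
    (fun ρ hρ => (hd ρ (Ico_subset_Icc_self hρ)).hasDerivWithinAt) 1 ⟨hc1, le_rfl⟩
  simp only [one_pow, inv_one, one_mul, sub_zero, one_smul] at h
  rw [h]
  have := pow_pos hc0 k
  field_simp

/-- Finite measures carried by an open set are determined by smooth test functions. -/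
theorem measure_eq_of_integral_contDiff_eq {ν₁ ν₂ : Measure (Euc n)} [IsFiniteMeasure ν₁]
    [IsFiniteMeasure ν₂] {W : Set (Euc n)} (hW : IsOpen W) (h₁ : ν₁ Wᶜ = 0) (h₂ : ν₂ Wᶜ = 0)
    (h : ∀ φ : Euc n → ℝ, ContDiff ℝ ∞ φ → HasCompactSupport φ → tsupport φ ⊆ W →
      ∫ x, φ x ∂ν₁ = ∫ x, φ x ∂ν₂) : ν₁ = ν₂ := by
  have key : ∀ (μ₁ μ₂ : Measure (Euc n)) [IsFiniteMeasure μ₁] [IsFiniteMeasure μ₂],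
      (∀ φ : Euc n → ℝ, ContDiff ℝ ∞ φ → HasCompactSupport φ → tsupport φ ⊆ W →
        ∫ x, φ x ∂μ₁ = ∫ x, φ x ∂μ₂) → ∀ U, IsOpen U → U ⊆ W → μ₁ U ≤ μ₂ U := by
    intro μ₁ μ₂ _ _ h U hU hUW
    rw [hU.measure_eq_iSup_isCompact]
    refine iSup₂_le fun K hKU => iSup_le fun hK => ?_
    obtain ⟨K', hK', hKK', hK'U⟩ := exists_compact_between hK hU hKU
    obtain ⟨φ, hφ0, hφ1, hφ01⟩ := exists_contMDiffMap_zero_one_of_isClosed (n := ⊤)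
      (modelWithCornersSelf ℝ (Euc n)) (isOpen_interior (s := K')).isClosed_compl hK.isClosed
      (disjoint_compl_left_iff_subset.2 hKK')
    have hsupp : tsupport φ ⊆ K' := by
      refine closure_minimal (fun x hx => ?_) hK'.isClosed
      by_contra hxK
      exact hx (hφ0 fun h => hxK (interior_subset h))
    have hcs : HasCompactSupport φ := hK'.of_isClosed_subset (isClosed_tsupport _) hsupp
    have hint : ∀ μ : Measure (Euc n), [IsFiniteMeasure μ] → Integrable φ μ := fun μ _ =>
      φ.contMDiff.continuous.integrable_of_hasCompactSupport hcs
    have h1 : μ₁.real K ≤ ∫ x, φ x ∂μ₁ := by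
      rw [← integral_indicator_one hK.measurableSet]
      refine integral_mono ((integrable_const 1).indicator hK.measurableSet) (hint μ₁) fun x => ?_
      simp only [indicator]
      split_ifs with hx
      · exact (hφ1 hx).ge
      · exact (hφ01 x).1
    have h2 : ∫ x, φ x ∂μ₂ ≤ μ₂.real U := by
      rw [← integral_indicator_one hU.measurableSet]
      refine integral_mono (hint μ₂) ((integrable_const 1).indicator hU.measurableSet) fun x => ?_
      simp only [indicator]
      split_ifs with hx
      · exact (hφ01 x).2
      · exact (hφ0 fun h => hx (hK'U (interior_subset h))).le
    have h3 := h φ φ.contMDiff.contDiff hcs (hsupp.trans (hK'U.trans hUW))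
    rw [← ENNReal.toReal_le_toReal (measure_ne_top _ _) (measure_ne_top _ _)]
    exact h1.trans (h3.trans_le h2)
  have hopen : ∀ U, IsOpen U → ν₁ U = ν₂ U := by
    intro U hU
    have hr : ∀ μ : Measure (Euc n), μ Wᶜ = 0 → μ U = μ (U ∩ W) := fun μ hμ =>
      (measure_inter_conull hμ).symm
    rw [hr ν₁ h₁, hr ν₂ h₂]
    exact le_antisymm (key ν₁ ν₂ h _ (hU.inter hW) inter_subset_right)
      (key ν₂ ν₁ (fun φ a b c => (h φ a b c).symm) _ (hU.inter hW) inter_subset_right)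
  refine ext_of_generate_finite _ (BorelSpace.measurable_eq (α := Euc n)) isPiSystem_isOpen
    (fun U hU => hopen U hU) (hopen univ isOpen_univ)

/-- The measure `μ` on the unit ball scales with exponent `k`. -/
def ConicalInBall (k : ℕ) (μ : Measure (Euc n)) : Prop :=
  ∀ c : ℝ, 0 < c → c ≤ 1 → (μ.restrict (ball 0 c)).map (fun x => c⁻¹ • x) =
    ENNReal.ofReal (c ^ k) • μ.restrict (ball 0 1)

/-- The weight of a radial stationary varifold is conical. -/
theorem StationaryIn.conicalInBall {V : Measure (Euc n × Gr n k)} [IsFiniteMeasure V]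
    (hV : StationaryIn V (ball 0 2))
    (hrad : ∀ᵐ p ∂V, p.1 ∈ ball (0 : Euc n) 1 → p.2.proj p.1 = p.1) :
    ConicalInBall k V.fst := by
  intro c hc0 hc1
  have hm : Measurable fun x : Euc n => c⁻¹ • x := by fun_prop
  have hfin : IsFiniteMeasure (ENNReal.ofReal (c ^ k) • V.fst.restrict (ball 0 1)) :=
    ⟨by simpa using ENNReal.mul_lt_top ENNReal.ofReal_lt_top (measure_lt_top _ _)⟩
  have hpre : (fun x : Euc n => c⁻¹ • x) ⁻¹' ball 0 1 = ball 0 c := by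
    ext x
    rw [mem_preimage, mem_ball_zero_iff, mem_ball_zero_iff, norm_smul, norm_inv,
      Real.norm_of_nonneg hc0.le, inv_mul_lt_iff₀ hc0, mul_one]
  refine measure_eq_of_integral_contDiff_eq isOpen_ball (W := ball 0 1) ?_ ?_ ?_
  · rw [Measure.map_apply hm measurableSet_ball.compl, preimage_compl, hpre,
      Measure.restrict_apply measurableSet_ball.compl, compl_inter_self, measure_empty]
  · rw [Measure.smul_apply, Measure.restrict_apply measurableSet_ball.compl, compl_inter_self,
      measure_empty, smul_zero]
  · intro φ hφ hcs hs
    have h0 : ∀ x, x ∉ ball (0 : Euc n) 1 → φ x = 0 := fun x hx => by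
      by_contra h; exact hx (hs (subset_tsupport φ h))
    rw [integral_map hm.aemeasurable hφ.continuous.aestronglyMeasurable, integral_smul_measure,
      setIntegral_eq_integral_of_forall_compl_eq_zero (s := ball 0 1) h0,
      setIntegral_eq_integral_of_forall_compl_eq_zero (s := ball 0 c) (fun x hx => h0 _ (by
        rwa [← hpre] at hx)),
      Measure.fst, integral_map measurable_fst.aemeasurable
        hφ.continuous.aestronglyMeasurable, integral_map (f := fun x => φ (c⁻¹ • x))
        measurable_fst.aemeasurable
        (Continuous.aestronglyMeasurable (hφ.continuous.comp (by fun_prop))),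
      ENNReal.toReal_ofReal (by positivity), smul_eq_mul]
    exact hV.integral_scale_eq hrad hφ hcs hs hc0 hc1

end ConicalWeight

/-! ### Tangent planes determined by the weight -/

section TangentPlanes

variable {n k : ℕ}

theorem tendsto_const_mul_nhdsGT_zero {b : ℝ} (hb : 0 < b) :
    Tendsto (fun r : ℝ => b * r) (𝓝[>] 0) (𝓝[>] 0) := by
  refine tendsto_nhdsWithin_iff.2 ⟨?_, ?_⟩
  · have : Tendsto (fun r : ℝ => b * r) (𝓝 0) (𝓝 (b * 0)) := tendsto_id.const_mul b
    rw [mul_zero] at this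
    exact this.mono_left nhdsWithin_le_nhds
  · filter_upwards [self_mem_nhdsWithin] with r hr using mul_pos hb (mem_Ioi.1 hr)

theorem fderiv_bounded {φ : Euc n → ℝ} (hφ : ContDiff ℝ ∞ φ) (hc : HasCompactSupport φ) :
    ∃ B : ℝ, 0 ≤ B ∧ ∀ y, ‖fderiv ℝ φ y‖ ≤ B := by
  obtain ⟨B, hB⟩ := (hφ.continuous_fderiv (by simp)).bounded_above_of_compact_support
    (hc.fderiv ℝ)
  exact ⟨B, (norm_nonneg _).trans (hB 0), hB⟩

theorem integrable_fderiv_scale {μ : Measure (Euc n)} [IsFiniteMeasure μ] {φ : Euc n → ℝ}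
    (hφ : ContDiff ℝ ∞ φ) (hc : HasCompactSupport φ) (r : ℝ) (a v : Euc n) :
    Integrable (fun x => fderiv ℝ φ (r⁻¹ • (x - a)) v) μ := by
  obtain ⟨B, -, hB⟩ := fderiv_bounded hφ hc
  refine Integrable.of_bound (Continuous.aestronglyMeasurable ?_) (B * ‖v‖)
    (Eventually.of_forall fun x => (fderiv ℝ φ (r⁻¹ • (x - a))).le_of_opNorm_le (hB _) v)
  exact ((hφ.continuous_fderiv (by simp)).comp (by fun_prop)).clm_apply continuous_const

/-- The directions along which the blow-ups `r⁻ᵏ (η_{a,r})_* μ` of `μ` at `a` become translation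
invariant as `r → 0`: the derivatives `∂_v φ` of test functions have integral tending to zero. For
a measure with positive finite `k`-density that is the weight of a stationary varifold, this is the
tangent plane. -/
def tangentDirections (k : ℕ) (μ : Measure (Euc n)) [IsFiniteMeasure μ] (a : Euc n) :
    Submodule ℝ (Euc n) where
  carrier := {v | ∀ φ : Euc n → ℝ, ContDiff ℝ ∞ φ → HasCompactSupport φ →
    Tendsto (fun r : ℝ => (r ^ k)⁻¹ * ∫ x, fderiv ℝ φ (r⁻¹ • (x - a)) v ∂μ) (𝓝[>] 0) (𝓝 0)}
  add_mem' := by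
    intro v w hv hw φ hφ hc
    have h := (hv φ hφ hc).add (hw φ hφ hc)
    rw [add_zero] at h
    refine h.congr fun r => ?_
    rw [← mul_add, ← integral_add (integrable_fderiv_scale hφ hc r a v)
      (integrable_fderiv_scale hφ hc r a w)]
    simp only [map_add]
  zero_mem' := by
    intro φ _ _
    simp
  smul_mem' := by
    intro c v hv φ hφ hc
    have h := (hv φ hφ hc).const_mul c
    rw [mul_zero] at h
    refine h.congr fun r => ?_
    simp only [map_smul, smul_eq_mul]
    rw [integral_const_mul]
    ring

theorem mem_tangentDirections {μ : Measure (Euc n)} [IsFiniteMeasure μ] {a v : Euc n} :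
    v ∈ tangentDirections k μ a ↔ ∀ φ : Euc n → ℝ, ContDiff ℝ ∞ φ → HasCompactSupport φ →
      Tendsto (fun r : ℝ => (r ^ k)⁻¹ * ∫ x, fderiv ℝ φ (r⁻¹ • (x - a)) v ∂μ)
        (𝓝[>] 0) (𝓝 0) := Iff.rfl

/-- The divergence along `tangentDirections` of a radial field has asymptotically vanishing
integral. -/
theorem tendsto_integral_div_tangentDirections {μ : Measure (Euc n)} [IsFiniteMeasure μ]
    {a : Euc n} {φ : Euc n → ℝ} (hφ : ContDiff ℝ ∞ φ) (hc : HasCompactSupport φ)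
    (D : Submodule ℝ (Euc n)) (hD : D ≤ tangentDirections k μ a) :
    Tendsto (fun r : ℝ => (r ^ k)⁻¹ * ∫ x, (Module.finrank ℝ D * φ (r⁻¹ • (x - a)) +
      fderiv ℝ φ (r⁻¹ • (x - a)) (D.starProjection (r⁻¹ • (x - a)))) ∂μ) (𝓝[>] 0) (𝓝 0) := by
  let e := stdOrthonormalBasis ℝ D
  have hsm : ∀ i, ContDiff ℝ ∞ fun y => inner ℝ (e i : Euc n) y * φ y := fun i =>
    (innerSL ℝ (e i : Euc n)).contDiff.mul hφ
  have hterm : ∀ i, Tendsto (fun r : ℝ => (r ^ k)⁻¹ *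
      ∫ x, fderiv ℝ (fun y => inner ℝ (e i : Euc n) y * φ y) (r⁻¹ • (x - a)) (e i) ∂μ)
      (𝓝[>] 0) (𝓝 0) := fun i => hD (e i).2 _ (hsm i) hc.mul_left
  have hsum := tendsto_finsetSum Finset.univ fun i _ => hterm i
  rw [Finset.sum_const_zero] at hsum
  refine hsum.congr fun r => ?_
  rw [← Finset.mul_sum, ← integral_finsetSum _ fun i _ =>
    integrable_fderiv_scale (hsm i) hc.mul_left r a _]
  congr 1
  refine integral_congr_ae (Eventually.of_forall fun x => ?_)
  simp only
  generalize r⁻¹ • (x - a) = y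
  have hder : ∀ i, fderiv ℝ (fun y => inner ℝ (e i : Euc n) y * φ y) y (e i) =
      φ y + inner ℝ (e i : Euc n) y * fderiv ℝ φ y (e i) := by
    intro i
    have h1 : HasFDerivAt (fun y : Euc n => inner ℝ (e i : Euc n) y) (innerSL ℝ (e i : Euc n)) y :=
      (innerSL ℝ (e i : Euc n)).hasFDerivAt
    have h2 := (h1.mul (hφ.differentiable (by simp) y).hasFDerivAt).fderiv
    have h3 : (fun y => inner ℝ (e i : Euc n) y * φ y) =
        (fun y : Euc n => inner ℝ (e i : Euc n) y) * φ := rfl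
    rw [h3, h2]
    have hn : inner ℝ (e i : Euc n) (e i : Euc n) = (1 : ℝ) := by
      rw [← Submodule.coe_inner, real_inner_self_eq_norm_sq, e.norm_eq_one, one_pow]
    simp only [add_apply, smul_apply, innerSL_apply_apply,
      smul_eq_mul, hn]
    ring
  have hproj : D.starProjection y = ∑ i, inner ℝ (e i : Euc n) y • (e i : Euc n) := by
    rw [e.starProjection_eq_sum_rankOne]
    simp
  simp only [hder, hproj, map_sum, map_smul, smul_eq_mul, Finset.sum_add_distrib,
    Finset.sum_const, Finset.card_univ, Fintype.card_fin, nsmul_eq_mul]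

/-- **Dimension bound.** Where `‖V‖` has positive lower and finite upper `k`-density, the space of
directions of asymptotic invariance has dimension at most `k`: an `m`-dimensional space with `m > k`
would force the density ratios to grow logarithmically. -/
theorem finrank_tangentDirections_le {V : Measure (Euc n × Gr n k)} [IsFiniteMeasure V]
    {a : Euc n} {c C : ℝ} (hc : 0 < c) (hlow : ∀ᶠ s in 𝓝[>] (0 : ℝ), c ≤ densityRatio V a s)
    (hup : ∀ᶠ s in 𝓝[>] (0 : ℝ), densityRatio V a s ≤ C) :
    Module.finrank ℝ (tangentDirections k V.fst a) ≤ k := by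
  by_contra! hm
  set D := tangentDirections k V.fst a
  obtain ⟨g, hg, hga, hgs, hg1, hg01⟩ := exists_cutoff (s := 1 / 4) (by norm_num)
  set φ : Euc n → ℝ := fun y => g (‖y‖ ^ 2) with hφdef
  have hφ : ContDiff ℝ ∞ φ := hg.comp (contDiff_norm_sq ℝ)
  have hφc : HasCompactSupport φ := radial_hasCompactSupport hg1
  have hE := tendsto_integral_div_tangentDirections (k := k) (μ := V.fst) (a := a) hφ hφc D le_rfl
  set m := Module.finrank ℝ D
  have hη : 0 < c / 2 ^ k / 2 := by positivity
  set η := c / 2 ^ k / 2 with hηdef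
  let Q : ℝ → ℝ := fun r => (r ^ k)⁻¹ * ∫ p, φ (r⁻¹ • (p.1 - a)) ∂V
  have hi1 : ∀ r : ℝ, Integrable (fun p : Euc n × Gr n k => φ (r⁻¹ • (p.1 - a))) V := fun r => by
    refine Integrable.of_bound (Continuous.aestronglyMeasurable
      (hφ.continuous.comp (by fun_prop))) 1 (Eventually.of_forall fun p => ?_)
    rw [Real.norm_of_nonneg (hg01 _).1]; exact (hg01 _).2
  -- `Q` is bounded above and below by density ratios.
  have hQup : ∀ r, 0 < r → Q r ≤ densityRatio V a r := by
    intro r hr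
    refine mul_le_mul_of_nonneg_left ?_ (by positivity)
    rw [← integral_indicator_ball_fst]
    refine integral_mono (hi1 r) (integrable_indicator_ball_fst V a r) fun p => ?_
    simp only [indicator]
    split_ifs with h
    · exact (hg01 _).2
    · exact le_of_eq (by_contra fun h' => h (radial_scale_support hg1 a hr h'))
  have hQlow : ∀ r, 0 < r → densityRatio V a (r / 2) / 2 ^ k ≤ Q r := by
    intro r hr
    have h1 : densityRatio V a (r / 2) / 2 ^ k = (r ^ k)⁻¹ * V.fst.real (ball a (r / 2)) := by
      rw [densityRatio, div_pow]; field_simp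
    rw [h1]
    refine mul_le_mul_of_nonneg_left ?_ (by positivity)
    rw [← integral_indicator_ball_fst]
    refine integral_mono (integrable_indicator_ball_fst V a _) (hi1 r) fun p => ?_
    simp only [indicator]
    split_ifs with h
    · refine (hgs _ ?_).ge
      rw [norm_smul, norm_inv, Real.norm_of_nonneg hr.le]
      rw [mem_ball, dist_eq_norm] at h
      have : r⁻¹ * ‖p.1 - a‖ ≤ 1 / 2 := by rw [inv_mul_le_iff₀ hr]; linarith
      calc (r⁻¹ * ‖p.1 - a‖) ^ 2 ≤ (1 / 2) ^ 2 := pow_le_pow_left₀ (by positivity) this 2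
        _ = 1 / 4 := by norm_num
    · exact (hg01 _).1
  have hQd : ∀ r, 0 < r → HasDerivAt Q (-(r⁻¹ * ((r ^ k)⁻¹ * ∫ p, (k * φ (r⁻¹ • (p.1 - a)) +
      fderiv ℝ φ (r⁻¹ • (p.1 - a)) (r⁻¹ • (p.1 - a))) ∂V))) r := by
    intro r hr
    have h1 := hasDerivAt_integral_scale (V := V) hφ hφc a hr
    have h2 : HasDerivAt (fun ρ : ℝ => (ρ ^ k)⁻¹) (-(k * r ^ (k - 1)) / (r ^ k) ^ 2) r :=
      (hasDerivAt_pow k r).inv (pow_pos hr k).ne'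
    have hi2 : Integrable (fun p : Euc n × Gr n k =>
        fderiv ℝ φ (r⁻¹ • (p.1 - a)) (r⁻¹ • (p.1 - a))) V :=
      integrable_of_hasCompactSupport_fst
        (φ := fun x => fderiv ℝ φ (r⁻¹ • (x - a)) (r⁻¹ • (x - a)))
        ((continuous_fderiv_apply_self hφ).comp (by fun_prop))
        ((hasCompactSupport_fderiv_apply_self hφc).comp_scale hr a)
    refine (h2.mul h1).congr_deriv ?_
    rw [integral_add ((hi1 r).const_mul _) hi2, integral_const_mul, integral_const_mul]
    rcases k with _ | k
    · simp
    · simp only [Nat.cast_add, Nat.cast_one, Nat.add_sub_cancel]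
      field_simp
      ring
  -- The differential inequality `r Q' ≥ (m - k) Q - o(1)`.
  have hQd' : ∀ᶠ r in 𝓝[>] (0 : ℝ), ∃ q, HasDerivAt Q q r ∧ η / r ≤ q := by
    have hhalf : Tendsto (fun r : ℝ => r / 2) (𝓝[>] 0) (𝓝[>] 0) :=
      (tendsto_const_mul_nhdsGT_zero one_half_pos).congr fun r => by ring
    filter_upwards [hhalf.eventually hlow, hE.eventually (gt_mem_nhds hη), self_mem_nhdsWithin]
      with r hr hEr hr0
    replace hr0 : 0 < r := hr0
    refine ⟨_, hQd r hr0, ?_⟩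
    have hQr : 2 * η ≤ Q r := by
      refine le_trans ?_ (hQlow r hr0)
      rw [hηdef, mul_div_cancel₀ _ two_ne_zero]
      gcongr
    rw [Measure.fst, integral_map measurable_fst.aemeasurable (Continuous.aestronglyMeasurable (by
      have hfd : Continuous (fderiv ℝ φ) := hφ.continuous_fderiv (by simp)
      have hφ' := hφ.continuous
      have h1 : Continuous fun x : Euc n => r⁻¹ • (x - a) := by fun_prop
      exact (continuous_const.mul (hφ'.comp h1)).add
        ((hfd.comp h1).clm_apply (D.starProjection.continuous.comp h1))))] at hEr
    have hcomp : (r ^ k)⁻¹ * ∫ p, (k * φ (r⁻¹ • (p.1 - a)) +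
        fderiv ℝ φ (r⁻¹ • (p.1 - a)) (r⁻¹ • (p.1 - a))) ∂V ≤
        (r ^ k)⁻¹ * ∫ p : Euc n × Gr n k, (m * φ (r⁻¹ • (p.1 - a)) +
      fderiv ℝ φ (r⁻¹ • (p.1 - a)) (D.starProjection (r⁻¹ • (p.1 - a)))) ∂V - Q r := by
      have hi2 : Integrable (fun p : Euc n × Gr n k =>
          fderiv ℝ φ (r⁻¹ • (p.1 - a)) (r⁻¹ • (p.1 - a))) V :=
        integrable_of_hasCompactSupport_fst
          (φ := fun x => fderiv ℝ φ (r⁻¹ • (x - a)) (r⁻¹ • (x - a)))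
          ((continuous_fderiv_apply_self hφ).comp (by fun_prop))
          ((hasCompactSupport_fderiv_apply_self hφc).comp_scale hr0 a)
      have hi3 : Integrable (fun p : Euc n × Gr n k =>
          fderiv ℝ φ (r⁻¹ • (p.1 - a)) (D.starProjection (r⁻¹ • (p.1 - a)))) V := by
        refine integrable_of_hasCompactSupport_fst
          (φ := fun x => fderiv ℝ φ (r⁻¹ • (x - a)) (D.starProjection (r⁻¹ • (x - a)))) ?_ ?_
        · have h1 : Continuous fun x : Euc n => r⁻¹ • (x - a) := by fun_prop
          exact ((hφ.continuous_fderiv (by simp)).comp h1).clm_apply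
            (D.starProjection.continuous.comp h1)
        · refine ((hφc.fderiv ℝ).comp_scale hr0 a).mono fun x hx hz => hx ?_
          simp only at hz ⊢
          rw [hz]; simp
      have hi4 : Integrable (fun p : Euc n × Gr n k => m * φ (r⁻¹ • (p.1 - a)) +
          fderiv ℝ φ (r⁻¹ • (p.1 - a)) (D.starProjection (r⁻¹ • (p.1 - a)))) V :=
        ((hi1 r).const_mul _).add hi3
      simp only [Q]
      rw [← mul_sub, ← integral_sub hi4 (hi1 r)]
      refine mul_le_mul_of_nonneg_left (integral_mono (((hi1 r).const_mul _).add hi2)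
        (hi4.sub (hi1 r)) fun p => ?_) (by positivity)
      simp only
      generalize r⁻¹ • (p.1 - a) = y
      have hmk : (k : ℝ) + 1 ≤ m := by exact_mod_cast hm
      have hφy : 0 ≤ φ y := (hg01 _).1
      have h1 : fderiv ℝ φ y y ≤ fderiv ℝ φ y (D.starProjection y) := by
        rw [hφdef, radial_fderiv hg, radial_fderiv hg]
        refine mul_le_mul_of_nonpos_left ?_ hga.deriv_nonpos
        have h2 : inner ℝ y (D.starProjection y) ≤ ‖y‖ * ‖y‖ :=
          (real_inner_le_norm _ _).trans
            (mul_le_mul_of_nonneg_left (D.norm_starProjection_apply_le y) (norm_nonneg y))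
        rw [real_inner_self_eq_norm_mul_norm]
        linarith
      nlinarith
    rw [div_le_iff₀ hr0]
    have h4 : -(r⁻¹ * ((r ^ k)⁻¹ * ∫ p, (k * φ (r⁻¹ • (p.1 - a)) +
      fderiv ℝ φ (r⁻¹ • (p.1 - a)) (r⁻¹ • (p.1 - a))) ∂V)) * r =
      -((r ^ k)⁻¹ * ∫ p, (k * φ (r⁻¹ • (p.1 - a)) +
      fderiv ℝ φ (r⁻¹ • (p.1 - a)) (r⁻¹ • (p.1 - a))) ∂V) := by field_simp
    rw [h4]
    linarith
  obtain ⟨r₀, hr₀, hsub⟩ := mem_nhdsGT_iff_exists_Ioo_subset.1 (hQd'.and hup)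
  replace hr₀ : 0 < r₀ := hr₀
  have hmono : MonotoneOn (fun r => Q r - η * Real.log r) (Ioo 0 r₀) := by
    have hd : ∀ r ∈ Ioo 0 r₀, ∃ q, 0 ≤ q ∧ HasDerivAt (fun r => Q r - η * Real.log r) q r := by
      intro r hr
      obtain ⟨⟨q, hq, hqr⟩, -⟩ := hsub hr
      refine ⟨q - η * r⁻¹, ?_, hq.sub ((Real.hasDerivAt_log hr.1.ne').const_mul η)⟩
      rw [← div_eq_mul_inv]; linarith
    refine monotoneOn_of_deriv_nonneg (convex_Ioo 0 r₀) (fun r hr => ?_) ?_ ?_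
    · obtain ⟨q, -, hq⟩ := hd r hr
      exact hq.continuousAt.continuousWithinAt
    · rw [interior_Ioo]
      intro r hr
      obtain ⟨q, -, hq⟩ := hd r hr
      exact hq.differentiableAt.differentiableWithinAt
    · rw [interior_Ioo]
      intro r hr
      obtain ⟨q, hq0, hq⟩ := hd r hr
      rw [hq.deriv]; exact hq0
  have hbound : ∀ r ∈ Ioo 0 (r₀ / 2), -(C - η * Real.log (r₀ / 2)) / η ≤ Real.log r := by
    intro r hr
    have h1 := hmono ⟨hr.1, by linarith [hr.2]⟩ ⟨half_pos hr₀, half_lt_self hr₀⟩ hr.2.le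
    have h2 : Q (r₀ / 2) ≤ C := (hQup _ (half_pos hr₀)).trans
      (hsub ⟨half_pos hr₀, half_lt_self hr₀⟩).2
    have h3 : 0 ≤ Q r := mul_nonneg (inv_nonneg.2 (pow_pos hr.1 k).le)
      (integral_nonneg fun p => (hg01 _).1)
    simp only at h1
    rw [div_le_iff₀ hη]
    linarith
  have hlog := Real.tendsto_log_nhdsGT_zero.eventually
    (eventually_lt_atBot (-(C - η * Real.log (r₀ / 2)) / η))
  obtain ⟨r, hr1, hr2⟩ := (hlog.and (Ioo_mem_nhdsGT (half_pos hr₀))).exists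
  exact absurd (hbound r hr2) (not_le.2 hr1)

end TangentPlanes

/-! ### The planes of a stationary varifold with positive density -/

section MeanPlane

open ProbabilityTheory

variable {n k : ℕ}

theorem integrable_proj (ν : Measure (Gr n k)) [IsFiniteMeasure ν] :
    Integrable (fun S : Gr n k => S.proj) ν :=
  Integrable.of_bound Gr.continuous_proj.aestronglyMeasurable 1
    (Eventually.of_forall fun S => S.norm_proj_le)

/-- If the mean of the projections onto `k`-planes takes values in a space `D` of dimension at most
`k`, then almost every plane is `D`. -/
theorem ae_eq_of_integral_proj_mem (ν : Measure (Gr n k)) [IsFiniteMeasure ν]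
    (D : Submodule ℝ (Euc n)) (hD : Module.finrank ℝ D ≤ k)
    (h : ∀ e, (∫ S, S.proj ∂ν : Euc n →L[ℝ] Euc n) e ∈ D) : ∀ᵐ S ∂ν, S.1 = D := by
  have hv : ∀ v ∈ Dᗮ, ∀ᵐ S : Gr n k ∂ν, S.proj v = 0 := by
    intro v hv
    have h0 : inner ℝ v ((∫ S, S.proj ∂ν : Euc n →L[ℝ] Euc n) v) = 0 :=
      Submodule.inner_left_of_mem_orthogonal (h v) hv
    rw [ContinuousLinearMap.integral_apply (integrable_proj ν) v,
      ← integral_inner ((integrable_proj ν).apply_continuousLinearMap v) v] at h0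
    have hsq : ∀ S : Gr n k, inner ℝ v (S.proj v) = ‖S.proj v‖ ^ 2 := by
      intro S
      have h1 : inner ℝ (v - S.proj v) (S.proj v) = 0 :=
        Submodule.inner_left_of_mem_orthogonal (Submodule.starProjection_apply_mem S.1 v)
          (Submodule.sub_starProjection_mem_orthogonal v)
      rw [inner_sub_left, real_inner_self_eq_norm_sq] at h1
      linarith
    simp only [hsq] at h0
    have hcont : Continuous fun S : Gr n k => ‖S.proj v‖ ^ 2 :=
      (Gr.continuous_proj.clm_apply continuous_const).norm.pow 2
    rw [integral_eq_zero_iff_of_nonneg (fun S => by positivity)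
      (hcont.integrable_of_hasCompactSupport (HasCompactSupport.of_compactSpace _))] at h0
    filter_upwards [h0] with S hS
    simpa using hS
  let b := Module.finBasis ℝ (Dᗮ : Submodule ℝ (Euc n))
  have hall : ∀ᵐ S : Gr n k ∂ν, ∀ i, S.proj (b i : Euc n) = 0 :=
    ae_all_iff.2 fun i => hv _ (b i).2
  filter_upwards [hall] with S hS
  refine Submodule.eq_of_le_of_finrank_le ?_ (by rw [S.2]; exact hD)
  have h1 : Dᗮ ≤ S.1ᗮ := by
    intro v hv
    have h2 : (⟨v, hv⟩ : Dᗮ) ∈ Submodule.span ℝ (range b) := by rw [b.span_eq]; trivial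
    have h3 : ∀ w ∈ Submodule.span ℝ (range b), S.proj (w : Euc n) = 0 := by
      intro w hw
      induction hw using Submodule.span_induction with
      | mem w hw => obtain ⟨i, rfl⟩ := hw; exact hS i
      | zero => simp
      | add x y _ _ hx hy => rw [Submodule.coe_add, map_add, hx, hy, add_zero]
      | smul c x _ hx => rw [Submodule.coe_smul, map_smul, hx, smul_zero]
    exact (Submodule.starProjection_apply_eq_zero_iff S.1).1 (h3 _ h2)
  have h4 := Submodule.orthogonal_le h1
  rwa [Submodule.orthogonal_orthogonal, Submodule.orthogonal_orthogonal] at h4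

/-- The mean over the fibre at `x` of the projections onto the planes of `V`. -/
def meanProj [Nonempty (Gr n k)] (V : Measure (Euc n × Gr n k)) [IsFiniteMeasure V]
    (x : Euc n) : Euc n →L[ℝ] Euc n :=
  ∫ S, S.proj ∂V.condKernel x

variable [Nonempty (Gr n k)] {V : Measure (Euc n × Gr n k)} [IsFiniteMeasure V]

theorem stronglyMeasurable_meanProj : StronglyMeasurable (meanProj V) :=
  StronglyMeasurable.integral_kernel_prod_right' (κ := V.condKernel)
    (f := fun p : Euc n × Gr n k => p.2.proj)
    (Gr.continuous_proj.comp continuous_snd).stronglyMeasurable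

theorem norm_meanProj_le (x : Euc n) : ‖meanProj V x‖ ≤ 1 := by
  have h := norm_integral_le_of_norm_le_const (μ := V.condKernel x)
    (Eventually.of_forall fun S : Gr n k => S.norm_proj_le)
  simpa [meanProj] using h

theorem integrable_meanProj (μ : Measure (Euc n)) [IsFiniteMeasure μ] :
    Integrable (meanProj V) μ :=
  Integrable.of_bound stronglyMeasurable_meanProj.aestronglyMeasurable 1
    (Eventually.of_forall fun x => norm_meanProj_le x)

/-- The first variation in a constant direction, in terms of the mean projections. -/
theorem StationaryIn.integral_fderiv_meanProj {U : Set (Euc n)} (hV : StationaryIn V U)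
    {φ : Euc n → ℝ} (hφ : ContDiff ℝ ∞ φ) (hc : HasCompactSupport φ) (hs : tsupport φ ⊆ U)
    (e : Euc n) : ∫ x, fderiv ℝ φ x (meanProj V x e) ∂V.fst = 0 := by
  obtain ⟨B, hB0, hB⟩ := fderiv_bounded hφ hc
  have hcont : Continuous fun p : Euc n × Gr n k => fderiv ℝ φ p.1 (p.2.proj e) :=
    ((hφ.continuous_fderiv (by simp)).comp continuous_fst).clm_apply
      ((Gr.continuous_proj.comp continuous_snd).clm_apply continuous_const)
  have hint : Integrable (fun p : Euc n × Gr n k => fderiv ℝ φ p.1 (p.2.proj e)) V := by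
    refine Integrable.of_bound hcont.aestronglyMeasurable (B * ‖e‖)
      (Eventually.of_forall fun p => ((fderiv ℝ φ p.1).le_of_opNorm_le (hB _) _).trans ?_)
    exact mul_le_mul_of_nonneg_left ((p.2.proj.le_opNorm e).trans
      (mul_le_of_le_one_left (norm_nonneg _) p.2.norm_proj_le)) hB0
  rw [← hV.integral_fderiv_proj hφ hc hs e, ← Measure.integral_condKernel hint]
  refine integral_congr_ae (Eventually.of_forall fun x => ?_)
  have h1 : meanProj V x e = ∫ S : Gr n k, S.proj e ∂V.condKernel x :=
    ContinuousLinearMap.integral_apply (integrable_proj _) e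
  simp only
  rw [h1]
  exact (ContinuousLinearMap.integral_comp_comm _
    ((integrable_proj _).apply_continuousLinearMap e)).symm

/-- At almost every point, the range of the mean projection consists of directions of asymptotic
translation invariance. -/
theorem StationaryIn.meanProj_mem_tangentDirections (hV : StationaryIn V (ball 0 2)) :
    ∀ᵐ a ∂V.fst, a ∈ ball (0 : Euc n) 2 →
      ∀ C, (∀ᶠ s in 𝓝[>] (0 : ℝ), densityRatio V a s ≤ C) →
        ∀ e, meanProj V a e ∈ tangentDirections k V.fst a := by
  filter_upwards [(Besicovitch.vitaliFamily V.fst).ae_tendsto_average_norm_sub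
    (integrable_meanProj (V := V) V.fst).locallyIntegrable] with a ha ha2 C hC e
  rw [mem_tangentDirections]
  intro φ hφ hc
  obtain ⟨B, hB0, hB⟩ := fderiv_bounded hφ hc
  obtain ⟨R, hR0, hR⟩ : ∃ R : ℝ, 0 < R ∧ tsupport φ ⊆ closedBall 0 R := by
    obtain ⟨R, hR⟩ := hc.isCompact.isBounded.subset_closedBall (0 : Euc n)
    exact ⟨max R 1, lt_max_of_lt_right one_pos,
      hR.trans (closedBall_subset_closedBall (le_max_left _ _))⟩
  rw [mem_ball_zero_iff] at ha2
  have havg := (ha.comp (Besicovitch.tendsto_filterAt V.fst a)).comp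
    (tendsto_const_mul_nhdsGT_zero hR0)
  have hlim := havg.const_mul (B * ‖e‖ * (C * (2 * R) ^ k))
  rw [mul_zero] at hlim
  refine squeeze_zero_norm' ?_ hlim
  have hsmall : ∀ᶠ r in 𝓝[>] (0 : ℝ), R * r < 2 - ‖a‖ :=
    (tendsto_const_mul_nhdsGT_zero hR0).eventually (eventually_of_mem
      (Ioo_mem_nhdsGT (by linarith : (0 : ℝ) < 2 - ‖a‖)) fun r hr => hr.2)
  filter_upwards [self_mem_nhdsWithin, hsmall,
    (tendsto_const_mul_nhdsGT_zero (by linarith : 0 < 2 * R)).eventually hC] with r hr0 hr hCr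
  replace hr0 : 0 < r := hr0
  have hsup0 : ∀ x, x ∉ closedBall a (R * r) → fderiv ℝ φ (r⁻¹ • (x - a)) = 0 := by
    intro x hx
    refine fderiv_of_notMem_tsupport ℝ fun h => hx ?_
    have h1 := hR h
    rw [mem_closedBall_zero_iff, norm_smul, norm_inv, Real.norm_of_nonneg hr0.le,
      inv_mul_le_iff₀ hr0] at h1
    rw [mem_closedBall, dist_eq_norm]; linarith
  have hstat := hV.integral_fderiv_meanProj (φ := fun x => φ (r⁻¹ • (x - a)))
    (hφ.comp (by fun_prop)) (hc.comp_scale hr0 a) (by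
      refine (closure_minimal (t := closedBall a (R * r)) (fun x hx => ?_)
        isClosed_closedBall).trans fun x hx => ?_
      · have h1 := hR (subset_tsupport φ hx)
        rw [mem_closedBall_zero_iff, norm_smul, norm_inv, Real.norm_of_nonneg hr0.le,
          inv_mul_le_iff₀ hr0] at h1
        rw [mem_closedBall, dist_eq_norm]; linarith
      · rw [mem_closedBall, dist_eq_norm] at hx
        have := norm_add_le (x - a) a
        rw [sub_add_cancel] at this
        rw [mem_ball_zero_iff]; linarith) (r • e)
  have hstat' : ∫ x, fderiv ℝ φ (r⁻¹ • (x - a)) (meanProj V x e) ∂V.fst = 0 := by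
    rw [← hstat]
    refine integral_congr_ae (Eventually.of_forall fun x => ?_)
    simp only
    rw [fderiv_comp_scale hφ, map_smul (meanProj V x), smul_smul, inv_mul_cancel₀ hr0.ne', one_smul]
  have hmeas : AEStronglyMeasurable
      (fun x => fderiv ℝ φ (r⁻¹ • (x - a)) (meanProj V x e)) V.fst := by
    have h1 : Continuous fun x : Euc n => fderiv ℝ φ (r⁻¹ • (x - a)) :=
      (hφ.continuous_fderiv (by simp)).comp (by fun_prop)
    have h2 : StronglyMeasurable fun x => meanProj V x e :=
      (ContinuousLinearMap.apply ℝ (Euc n) e).continuous.comp_stronglyMeasurable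
        stronglyMeasurable_meanProj
    have h3 : Continuous fun q : (Euc n →L[ℝ] ℝ) × Euc n => q.1 q.2 :=
      continuous_fst.clm_apply continuous_snd
    exact (h3.comp_stronglyMeasurable
      (h1.stronglyMeasurable.prodMk h2)).aestronglyMeasurable
  have hint1 : Integrable (fun x => fderiv ℝ φ (r⁻¹ • (x - a)) (meanProj V x e)) V.fst := by
    refine Integrable.of_bound hmeas (B * ‖e‖) (Eventually.of_forall fun x =>
      ((fderiv ℝ φ (r⁻¹ • (x - a))).le_of_opNorm_le (hB _) _).trans ?_)
    exact mul_le_mul_of_nonneg_left (((meanProj V x).le_opNorm e).trans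
      (mul_le_of_le_one_left (norm_nonneg _) (norm_meanProj_le x))) hB0
  have hdiff : ∫ x, fderiv ℝ φ (r⁻¹ • (x - a)) (meanProj V a e) ∂V.fst =
      ∫ x in closedBall a (R * r),
        fderiv ℝ φ (r⁻¹ • (x - a)) ((meanProj V a - meanProj V x) e) ∂V.fst := by
    rw [setIntegral_eq_integral_of_forall_compl_eq_zero fun x hx => by rw [hsup0 x hx]; rfl]
    have := integral_sub (integrable_fderiv_scale (μ := V.fst) hφ hc r a (meanProj V a e)) hint1
    rw [hstat', sub_zero] at this
    rw [← this]
    refine integral_congr_ae (Eventually.of_forall fun x => ?_)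
    simp only [sub_apply, map_sub]
  have hmr : (r ^ k)⁻¹ * V.fst.real (closedBall a (R * r)) ≤ C * (2 * R) ^ k := by
    have h1 : V.fst.real (closedBall a (R * r)) ≤ V.fst.real (ball a (2 * R * r)) :=
      measureReal_mono (closedBall_subset_ball (by nlinarith))
    have h2 : (r ^ k)⁻¹ * V.fst.real (ball a (2 * R * r)) =
        densityRatio V a (2 * R * r) * (2 * R) ^ k := by
      rw [densityRatio, mul_pow]
      have := pow_pos hr0 k
      have := pow_pos (by linarith : 0 < 2 * R) k
      field_simp
    calc (r ^ k)⁻¹ * V.fst.real (closedBall a (R * r))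
        ≤ (r ^ k)⁻¹ * V.fst.real (ball a (2 * R * r)) := by gcongr
      _ ≤ C * (2 * R) ^ k := by
        rw [h2]
        exact mul_le_mul_of_nonneg_right hCr (by positivity)
  have hnorm : ‖∫ x, fderiv ℝ φ (r⁻¹ • (x - a)) (meanProj V a e) ∂V.fst‖ ≤
      B * ‖e‖ * (V.fst.real (closedBall a (R * r)) *
        ⨍ x in closedBall a (R * r), ‖meanProj V x - meanProj V a‖ ∂V.fst) := by
    rw [hdiff, ← smul_eq_mul (V.fst.real _), measure_smul_setAverage _ (measure_ne_top _ _),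
      ← integral_const_mul]
    refine norm_integral_le_of_norm_le
      ((((integrable_meanProj V.fst).sub (integrable_const _)).norm.const_mul _).integrableOn)
      (Eventually.of_forall fun x => ?_)
    refine ((fderiv ℝ φ (r⁻¹ • (x - a))).le_of_opNorm_le (hB _) _).trans ?_
    rw [mul_assoc, mul_comm ‖e‖]
    refine mul_le_mul_of_nonneg_left (((meanProj V a - meanProj V x).le_opNorm e).trans ?_) hB0
    rw [norm_sub_rev]
  have havg0 : 0 ≤ ⨍ x in closedBall a (R * r), ‖meanProj V x - meanProj V a‖ ∂V.fst := by
    rw [setAverage_eq]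
    exact smul_nonneg (inv_nonneg.2 measureReal_nonneg) (integral_nonneg fun _ => norm_nonneg _)
  rw [norm_mul, norm_inv, norm_pow, Real.norm_of_nonneg hr0.le]
  calc (r ^ k)⁻¹ * ‖∫ x, fderiv ℝ φ (r⁻¹ • (x - a)) (meanProj V a e) ∂V.fst‖
      ≤ (r ^ k)⁻¹ * (B * ‖e‖ * (V.fst.real (closedBall a (R * r)) *
        ⨍ x in closedBall a (R * r), ‖meanProj V x - meanProj V a‖ ∂V.fst)) := by gcongr
    _ = B * ‖e‖ * ((r ^ k)⁻¹ * V.fst.real (closedBall a (R * r))) *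
        ⨍ x in closedBall a (R * r), ‖meanProj V x - meanProj V a‖ ∂V.fst := by ring
    _ ≤ B * ‖e‖ * (C * (2 * R) ^ k) *
        ⨍ x in closedBall a (R * r), ‖meanProj V x - meanProj V a‖ ∂V.fst := by gcongr

/-- A stationary varifold with positive lower density is determined by its weight: almost every
plane is the space of directions of asymptotic invariance of the weight. -/
theorem StationaryIn.ae_eq_tangentDirections (hV : StationaryIn V (ball 0 2)) {c : ℝ} (hc : 0 < c)
    (hlow : ∀ᵐ a ∂V.fst, a ∈ ball (0 : Euc n) 2 →
      ∀ᶠ s in 𝓝[>] (0 : ℝ), c ≤ densityRatio V a s) :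
    ∀ᵐ p ∂V, p.1 ∈ ball (0 : Euc n) 2 → p.2.1 = tangentDirections k V.fst p.1 := by
  have hfib : ∀ᵐ a ∂V.fst, a ∈ ball (0 : Euc n) 2 →
      ∀ᵐ S ∂V.condKernel a, S.1 = tangentDirections k V.fst a := by
    filter_upwards [hV.meanProj_mem_tangentDirections, hlow] with a ha hla ha2
    have hup : ∃ C, ∀ᶠ s in 𝓝[>] (0 : ℝ), densityRatio V a s ≤ C := by
      have hpos : 0 < 2 - ‖a‖ := by linarith [mem_ball_zero_iff.1 ha2]
      have hsub : ball a (2 - ‖a‖) ⊆ ball 0 2 := ball_subset_ball' (by simp)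
      refine ⟨densityRatio V a ((2 - ‖a‖) / 2), eventually_of_mem (Ioo_mem_nhdsGT (half_pos hpos))
        fun s hs => hV.densityRatio_mono hs.1 hs.2.le (half_lt_self hpos) hsub⟩
    obtain ⟨C, hC⟩ := hup
    exact ae_eq_of_integral_proj_mem _ _ (finrank_tangentDirections_le hc (hla ha2) hC)
      (ha ha2 C hC)
  have hproj : ∀ (D : Submodule ℝ (Euc n)) (S : Gr n k), S.1 = D → S.proj = D.starProjection := by
    rintro D S rfl
    rfl
  -- The fibrewise statement is transferred to `V` through the measurable map `meanProj V`.
  have hmean : ∀ᵐ a ∂V.fst, a ∈ ball (0 : Euc n) 2 →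
      meanProj V a = (tangentDirections k V.fst a).starProjection := by
    filter_upwards [hfib] with a ha ha2
    rw [meanProj, integral_congr_ae ((ha ha2).mono fun S hS => hproj _ S hS), integral_const]
    simp
  have hmeas : MeasurableSet {p : Euc n × Gr n k | p.1 ∈ ball (0 : Euc n) 2 →
      p.2.proj = meanProj V p.1} := by
    have h1 : MeasurableSet {p : Euc n × Gr n k | p.2.proj = meanProj V p.1} :=
      measurableSet_eq_fun (Gr.continuous_proj.measurable.comp measurable_snd)
        (stronglyMeasurable_meanProj.measurable.comp measurable_fst)
    exact (measurable_fst measurableSet_ball).himp h1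
  have hV1 : ∀ᵐ p ∂V, p.1 ∈ ball (0 : Euc n) 2 → p.2.proj = meanProj V p.1 := by
    have h1 := (Measure.ae_compProd_iff (μ := V.fst) (κ := V.condKernel) hmeas).2 (by
      filter_upwards [hfib, hmean] with a ha hma
      by_cases ha2 : a ∈ ball (0 : Euc n) 2
      · filter_upwards [ha ha2] with S hS _
        rw [hma ha2, hproj _ S hS]
      · exact Eventually.of_forall fun S h => absurd h ha2)
    rwa [V.disintegrate V.condKernel] at h1
  have hV2 : ∀ᵐ p ∂V, p.1 ∈ ball (0 : Euc n) 2 →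
      meanProj V p.1 = (tangentDirections k V.fst p.1).starProjection :=
    ae_of_ae_map measurable_fst.aemeasurable hmean
  filter_upwards [hV1, hV2] with p h1 h2 hp
  have h3 : (p.2.1).starProjection = (tangentDirections k V.fst p.1).starProjection :=
    (h1 hp).trans (h2 hp)
  rw [← Submodule.range_starProjection p.2.1, ← Submodule.range_starProjection
    (tangentDirections k V.fst p.1)]
  exact congrArg (fun L : Euc n →L[ℝ] Euc n => L.range) h3

end MeanPlane

/-! ### Conical varifolds -/

section Cones

open ProbabilityTheory

variable {n k : ℕ}

theorem ConicalInBall.integral_comp {μ : Measure (Euc n)} (hμ : ConicalInBall k μ) {c : ℝ}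
    (hc0 : 0 < c) (hc1 : c ≤ 1) {ψ : Euc n → ℝ} (hψ : Continuous ψ)
    (h0 : ∀ x, x ∉ ball (0 : Euc n) 1 → ψ x = 0) :
    ∫ x, ψ (c⁻¹ • x) ∂μ = c ^ k * ∫ x, ψ x ∂μ := by
  have hm : Measurable fun x : Euc n => c⁻¹ • x := by fun_prop
  have h := congrArg (fun ν => ∫ x, ψ x ∂ν) (hμ c hc0 hc1)
  rw [integral_map hm.aemeasurable hψ.aestronglyMeasurable, integral_smul_measure,
    setIntegral_eq_integral_of_forall_compl_eq_zero (s := ball 0 1) h0,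
    setIntegral_eq_integral_of_forall_compl_eq_zero (s := ball 0 c) fun x hx => h0 _ fun h1 => hx
      (by
        rw [mem_ball_zero_iff, norm_smul, norm_inv, Real.norm_of_nonneg hc0.le,
          inv_mul_lt_iff₀ hc0, mul_one] at h1
        exact mem_ball_zero_iff.2 h1),
    ENNReal.toReal_ofReal (by positivity), smul_eq_mul] at h
  exact h

/-- The directions of asymptotic invariance of a conical measure are constant along rays. -/
theorem ConicalInBall.tangentDirections_smul {μ : Measure (Euc n)} [IsFiniteMeasure μ]
    (hμ : ConicalInBall k μ) {c : ℝ} (hc0 : 0 < c) (hc1 : c ≤ 1) {a : Euc n}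
    (ha : a ∈ ball (0 : Euc n) 1) :
    tangentDirections k μ (c • a) = tangentDirections k μ a := by
  have key : ∀ (v : Euc n) (φ : Euc n → ℝ), ContDiff ℝ ∞ φ → HasCompactSupport φ →
      ∀ᶠ s in 𝓝[>] (0 : ℝ),
        ((c * s) ^ k)⁻¹ * ∫ x, fderiv ℝ φ ((c * s)⁻¹ • (x - c • a)) v ∂μ =
          (s ^ k)⁻¹ * ∫ x, fderiv ℝ φ (s⁻¹ • (x - a)) v ∂μ := by
    intro v φ hφ hφc
    obtain ⟨R, hR⟩ := hφc.isCompact.isBounded.subset_closedBall (0 : Euc n)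
    have hpos : 0 < 1 - ‖a‖ := by linarith [mem_ball_zero_iff.1 ha]
    have hlim : Tendsto (fun s : ℝ => R * s) (𝓝[>] 0) (𝓝 0) := by
      have : Tendsto (fun s : ℝ => R * s) (𝓝 0) (𝓝 (R * 0)) := tendsto_id.const_mul R
      rw [mul_zero] at this
      exact this.mono_left nhdsWithin_le_nhds
    filter_upwards [self_mem_nhdsWithin, hlim.eventually (gt_mem_nhds hpos)] with s hs0 hs
    replace hs0 : 0 < s := hs0
    have h1 := hμ.integral_comp hc0 hc1 (ψ := fun x => fderiv ℝ φ (s⁻¹ • (x - a)) v)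
      (((hφ.continuous_fderiv (by simp)).comp (by fun_prop)).clm_apply continuous_const) (by
        intro x hx
        have h2 : s⁻¹ • (x - a) ∉ tsupport φ := fun h => hx (by
          have h3 := hR h
          rw [mem_closedBall_zero_iff, norm_smul, norm_inv, Real.norm_of_nonneg hs0.le,
            inv_mul_le_iff₀ hs0] at h3
          have h4 := norm_add_le (x - a) a
          rw [sub_add_cancel] at h4
          rw [mem_ball_zero_iff]; linarith)
        rw [fderiv_of_notMem_tsupport ℝ h2]; rfl)
    have h5 : ∀ x : Euc n, (c * s)⁻¹ • (x - c • a) = s⁻¹ • (c⁻¹ • x - a) := by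
      intro x
      rw [mul_inv, mul_comm, mul_smul, smul_sub c⁻¹, smul_smul c⁻¹ c, inv_mul_cancel₀ hc0.ne',
        one_smul]
    simp only [h5]
    rw [h1, mul_pow]
    have := pow_pos hc0 k
    have := pow_pos hs0 k
    field_simp
  ext v
  rw [mem_tangentDirections, mem_tangentDirections]
  refine forall_congr' fun φ => forall_congr' fun hφ => forall_congr' fun hφc => ⟨fun h => ?_,
    fun h => ?_⟩
  · exact (h.comp (tendsto_const_mul_nhdsGT_zero hc0)).congr' (key v φ hφ hφc)
  · have h1 := (tendsto_congr' (key v φ hφ hφc)).2 h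
    refine (h1.comp (tendsto_const_mul_nhdsGT_zero (inv_pos.2 hc0))).congr fun r => ?_
    simp only [Function.comp_apply]
    rw [← mul_assoc, mul_inv_cancel₀ hc0.ne', one_mul]

/-- Two measures on a product with the same first marginal that are both carried by the graph of
one function are equal. The graph is given by a relation and need not be measurable. -/
theorem measure_eq_of_ae_graph {X Y : Type*} [MeasurableSpace X] [MeasurableSpace Y]
    [StandardBorelSpace Y] [Nonempty Y] {L L' : Measure (X × Y)} [IsFiniteMeasure L]
    [IsFiniteMeasure L'] (hfst : L.fst = L'.fst) {P : X → Y → Prop}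
    (hP : ∀ x y y', P x y → P x y' → y = y') (hL : ∀ᵐ p ∂L, P p.1 p.2)
    (hR : ∀ᵐ p ∂L', P p.1 p.2) : L = L' := by
  have hfib : ∀ (W : Measure (X × Y)) [IsFiniteMeasure W], (∀ᵐ p ∂W, P p.1 p.2) →
      ∀ᵐ x ∂W.fst, ∀ᵐ y ∂W.condKernel x, P x y := by
    intro W _ hW
    refine Measure.ae_ae_of_ae_compProd (p := fun p => P p.1 p.2) ?_
    rwa [W.disintegrate W.condKernel]
  have hker : L.condKernel =ᵐ[L.fst] L'.condKernel := by
    have h2 := hfib L' hR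
    rw [← hfst] at h2
    filter_upwards [hfib L hL, h2] with x hxL hxR
    obtain ⟨y, hy⟩ := hxL.exists
    have hLy : ∀ᵐ z ∂L.condKernel x, z = y := hxL.mono fun z hz => hP x z y hz hy
    have hRy : ∀ᵐ z ∂L'.condKernel x, z = y := hxR.mono fun z hz => hP x z y hz hy
    have hd : ∀ (ν : Measure Y) [IsProbabilityMeasure ν], (∀ᵐ z ∂ν, z = y) →
        ν = Measure.dirac y := by
      intro ν _ hν
      have h3 : ν.map id = ν.map fun _ => y := Measure.map_congr hν
      rwa [Measure.map_id, Measure.map_const, measure_univ, one_smul] at h3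
    rw [hd _ hLy, hd _ hRy]
  rw [← L.disintegrate L.condKernel, ← L'.disintegrate L'.condKernel, ← hfst]
  exact Measure.compProd_congr hker

/-- Dilation by `c` of the base points of planes. -/
def dilation (n k : ℕ) (c : ℝ) (p : Euc n × Gr n k) : Euc n × Gr n k := (c • p.1, p.2)

theorem measurable_dilation (c : ℝ) : Measurable (dilation n k c) :=
  (measurable_fst.const_smul c).prodMk measurable_snd

theorem dilation_comp (b c : ℝ) : dilation n k b ∘ dilation n k c = dilation n k (b * c) := by
  funext p
  simp [dilation, smul_smul]

theorem dilation_one : dilation n k 1 = id := by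
  funext p
  simp [dilation]

theorem measurableEmbedding_dilation {c : ℝ} (hc : c ≠ 0) :
    MeasurableEmbedding (dilation n k c) :=
  ((Homeomorph.smulOfNeZero c hc).prodCongr (Homeomorph.refl (Gr n k))).measurableEmbedding

/-- The planes with base point in the ball `B_s`. -/
def cyl (n k : ℕ) (s : ℝ) : Set (Euc n × Gr n k) := ball 0 s ×ˢ univ

theorem measurableSet_cyl (s : ℝ) : MeasurableSet (cyl n k s) :=
  measurableSet_ball.prod MeasurableSet.univ

theorem mem_cyl {s : ℝ} {p : Euc n × Gr n k} : p ∈ cyl n k s ↔ ‖p.1‖ < s := by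
  simp [cyl]

theorem dilation_preimage_cyl {c : ℝ} (hc : 0 < c) (s : ℝ) :
    dilation n k c ⁻¹' cyl n k s = cyl n k (s / c) := by
  ext p
  rw [mem_preimage, mem_cyl, mem_cyl, dilation, norm_smul, Real.norm_of_nonneg hc.le,
    lt_div_iff₀ hc, mul_comm]

/-- A stationary radial varifold whose planes are determined by the weight is conical in the unit
ball. -/
theorem ConicalInBall.map_dilation [Nonempty (Gr n k)] {V : Measure (Euc n × Gr n k)}
    [IsFiniteMeasure V] (hμ : ConicalInBall k V.fst)
    (hT : ∀ᵐ p ∂V, p.1 ∈ ball (0 : Euc n) 2 → p.2.1 = tangentDirections k V.fst p.1) {c : ℝ}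
    (hc0 : 0 < c) (hc1 : c ≤ 1) :
    (V.restrict (cyl n k c)).map (dilation n k c⁻¹) =
      ENNReal.ofReal (c ^ k) • V.restrict (cyl n k 1) := by
  have hfin : IsFiniteMeasure (ENNReal.ofReal (c ^ k) • V.restrict (cyl n k 1)) :=
    ⟨by simpa using ENNReal.mul_lt_top ENNReal.ofReal_lt_top (measure_lt_top _ _)⟩
  have hrestr : ∀ s : ℝ, (V.restrict (cyl n k s)).map Prod.fst =
      V.fst.restrict (ball 0 s) := by
    intro s
    rw [Measure.fst, Measure.restrict_map measurable_fst measurableSet_ball]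
    congr 2
    ext p
    simp [cyl]
  refine measure_eq_of_ae_graph (P := fun x S => S.1 = tangentDirections k V.fst x) ?_
    (fun x S S' h h' => Subtype.ext (h.trans h'.symm)) ?_ ?_
  · have h1 : Prod.fst ∘ dilation n k c⁻¹ = (fun x : Euc n => c⁻¹ • x) ∘ Prod.fst := rfl
    rw [Measure.fst, Measure.map_map measurable_fst (measurable_dilation _), h1,
      ← Measure.map_map (by fun_prop) measurable_fst, hrestr, hμ c hc0 hc1]
    change _ = Measure.map Prod.fst _
    rw [Measure.map_smul, hrestr]
  · rw [(measurableEmbedding_dilation (inv_ne_zero hc0.ne')).ae_map_iff,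
      ae_restrict_iff' (measurableSet_cyl c)]
    filter_upwards [hT] with p hp hpc
    rw [mem_cyl] at hpc
    have h2 : c⁻¹ • p.1 ∈ ball (0 : Euc n) 1 := by
      rw [mem_ball_zero_iff, norm_smul, norm_inv, Real.norm_of_nonneg hc0.le,
        inv_mul_lt_iff₀ hc0, mul_one]
      exact hpc
    have h3 := hμ.tangentDirections_smul hc0 hc1 h2
    rw [smul_smul, mul_inv_cancel₀ hc0.ne', one_smul] at h3
    simp only [dilation]
    rw [hp (mem_ball_zero_iff.2 (by linarith)), h3]
  · refine Measure.ae_smul_measure ?_ _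
    rw [ae_restrict_iff' (measurableSet_cyl 1)]
    filter_upwards [hT] with p hp hp1
    rw [mem_cyl] at hp1
    exact hp (mem_ball_zero_iff.2 (by linarith))

/-- Compatible measures on an increasing sequence of sets glue to one measure. -/
theorem exists_measure_restrict_eq {X : Type*} [MeasurableSpace X] {E : ℕ → Set X}
    (hE : ∀ m, MeasurableSet (E m)) (hmono : Monotone E) {C : ℕ → Measure X}
    (hC : ∀ i m, i ≤ m → (C m).restrict (E i) = C i) :
    ∃ J : Measure X, ∀ m, J.restrict (E m) = C m := by
  refine ⟨Measure.sum fun i => (C i).restrict (disjointed E i), fun m => ?_⟩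
  have hd : ∀ i, MeasurableSet (disjointed E i) := fun i => MeasurableSet.disjointed hE i
  have hterm : ∀ i, ((C i).restrict (disjointed E i)).restrict (E m) =
      (C m).restrict (disjointed E i) := by
    intro i
    rw [Measure.restrict_restrict (hE m)]
    rcases le_or_gt i m with him | him
    · rw [inter_eq_right.2 ((disjointed_subset E i).trans (hmono him)), ← hC i m him,
        Measure.restrict_restrict (hd i), inter_eq_left.2 (disjointed_subset E i)]
    · have h1 : E m ∩ disjointed E i = ∅ := by
        rw [← disjoint_iff_inter_eq_empty]
        refine disjoint_left.2 fun x hx hxi => ?_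
        rw [disjointed_eq_inter_compl] at hxi
        exact mem_iInter₂.1 hxi.2 m him hx
      have h3 : (C m).restrict (disjointed E i) = 0 := by
        rw [← hC m m le_rfl, Measure.restrict_restrict (hd i), inter_comm, h1,
          Measure.restrict_empty]
      rw [h1, h3, Measure.restrict_empty]
  rw [Measure.restrict_sum _ (hE m)]
  simp only [hterm]
  rw [← Measure.restrict_iUnion (disjoint_disjointed E) hd, iUnion_disjointed,
    ← hC m m le_rfl, Measure.restrict_restrict (MeasurableSet.iUnion hE),
    inter_eq_right.2 (subset_iUnion E m)]

/-- A finite measure which is conical in the unit ball extends to a conical varifold on `ℝⁿ`. -/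
theorem exists_conical_extension {W : Measure (Euc n × Gr n k)} [IsFiniteMeasure W]
    (hW : ∀ c : ℝ, 0 < c → c ≤ 1 → (W.restrict (cyl n k c)).map (dilation n k c⁻¹) =
      ENNReal.ofReal (c ^ k) • W.restrict (cyl n k 1)) :
    ∃ J : Varifold n k univ, J.IsConical 0 ∧
      J.toMeasure.restrict (cyl n k 1) = W.restrict (cyl n k 1) := by
  -- `C s` is the measure that the cone has to induce on the ball of radius `s`.
  let C : ℝ → Measure (Euc n × Gr n k) := fun s =>
    ENNReal.ofReal (s ^ k) • (W.restrict (cyl n k 1)).map (dilation n k s)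
  have hC1 : C 1 = W.restrict (cyl n k 1) := by
    simp only [C, one_pow, ENNReal.ofReal_one, one_smul, dilation_one, Measure.map_id]
  have hCdil : ∀ b s : ℝ, 0 < b →
      ENNReal.ofReal (b ^ k) • (C s).map (dilation n k b) = C (b * s) := by
    intro b s hb
    simp only [C]
    rw [Measure.map_smul, Measure.map_map (measurable_dilation b) (measurable_dilation s),
      dilation_comp, smul_smul, ← ENNReal.ofReal_mul (by positivity), ← mul_pow]
  have hCrestr : ∀ s t : ℝ, 0 < s → s ≤ t → (C t).restrict (cyl n k s) = C s := by
    intro s t hs hst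
    have ht : 0 < t := hs.trans_le hst
    have hc0 : 0 < s / t := div_pos hs ht
    have hc1 : s / t ≤ 1 := (div_le_one ht).2 hst
    have h1 : W.restrict (cyl n k (s / t)) = C (s / t) := by
      have h2 := congrArg (fun ν => ν.map (dilation n k (s / t))) (hW (s / t) hc0 hc1)
      rw [Measure.map_map (measurable_dilation _) (measurable_dilation _), dilation_comp,
        mul_inv_cancel₀ hc0.ne', dilation_one, Measure.map_id, Measure.map_smul] at h2
      exact h2
    have h3 : cyl n k (s / t) ∩ cyl n k 1 = cyl n k (s / t) := by
      refine inter_eq_left.2 fun p hp => ?_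
      rw [mem_cyl] at hp ⊢
      linarith
    have h4 := hCdil t (s / t) ht
    rw [mul_div_cancel₀ _ ht.ne'] at h4
    rw [← h4, ← h1]
    simp only [C]
    rw [Measure.restrict_smul, Measure.restrict_map (measurable_dilation t) (measurableSet_cyl s),
      dilation_preimage_cyl ht, Measure.restrict_restrict (measurableSet_cyl _), h3]
  have hcyl : ∀ s t : ℝ, s ≤ t → cyl n k s ⊆ cyl n k t := fun s t hst p hp => by
    rw [mem_cyl] at hp ⊢
    linarith
  obtain ⟨J, hJ⟩ := exists_measure_restrict_eq (E := fun m : ℕ => cyl n k ((m : ℝ) + 1))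
    (C := fun m => C ((m : ℝ) + 1)) (fun m => measurableSet_cyl _)
    (fun i m him => hcyl _ _ (by simpa using him))
    (fun i m him => hCrestr _ _ (by positivity) (by simpa using him))
  have hJs : ∀ s : ℝ, 0 < s → J.restrict (cyl n k s) = C s := by
    intro s hs
    obtain ⟨m, hm⟩ := exists_nat_ge s
    have h1 : s ≤ (m : ℝ) + 1 := by linarith
    rw [← hCrestr s _ hs h1, ← hJ m, Measure.restrict_restrict (measurableSet_cyl s),
      inter_eq_left.2 (hcyl _ _ h1)]
  have hCfin : ∀ s, C s univ < ⊤ := by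
    intro s
    simp only [C, Measure.smul_apply, smul_eq_mul]
    exact ENNReal.mul_lt_top ENNReal.ofReal_lt_top (measure_lt_top _ _)
  refine ⟨⟨J, by simp, fun K _ hK => ?_⟩, ⟨fun c hc => ?_, ⊥, by simp, ?_⟩, ?_⟩
  · obtain ⟨R, hR⟩ := hK.isBounded.subset_ball (0 : Euc n)
    have h1 : K ×ˢ (univ : Set (Gr n k)) ⊆ cyl n k (max R 1) :=
      prod_mono (hR.trans (ball_subset_ball (le_max_left _ _))) (subset_univ _)
    refine lt_of_le_of_lt ?_ (hCfin (max R 1))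
    rw [← hJs _ (lt_max_of_lt_right one_pos), Measure.restrict_apply_univ]
    exact measure_mono h1
  · change ENNReal.ofReal (c ^ k) • J.map (dilation n k c) = J
    have hcover : ⋃ m : ℕ, cyl n k ((m : ℝ) + 1) = univ := by
      refine eq_univ_of_forall fun p => mem_iUnion.2 ?_
      obtain ⟨m, hm⟩ := exists_nat_ge ‖p.1‖
      exact ⟨m, mem_cyl.2 (by linarith)⟩
    refine Measure.ext_of_iUnion_eq_univ hcover fun m => ?_
    have hm : (0 : ℝ) < (m : ℝ) + 1 := by positivity
    rw [Measure.restrict_smul, Measure.restrict_map (measurable_dilation c) (measurableSet_cyl _),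
      dilation_preimage_cyl hc, hJs _ (div_pos hm hc), hJs _ hm, hCdil _ _ hc,
      mul_div_cancel₀ _ hc.ne']
  · intro w hw
    rw [(Submodule.mem_bot ℝ).1 hw]
    simp
  · exact (hJs 1 one_pos).trans hC1

end Cones

/-! ### Rectifiable currents and the rigidity theorem -/

section Rigidity

variable {n k : ℕ}

/-- The integral of the tent function over a `k`-plane. It depends on `k` only. -/
def tentMass (k : ℕ) : ℝ := ∫ y : Euc k, max 0 (1 - ‖y‖)

theorem hasCompactSupport_tent (m : ℕ) : HasCompactSupport fun y : Euc m => max 0 (1 - ‖y‖) := by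
  refine HasCompactSupport.of_support_subset_isCompact (isCompact_closedBall (0 : Euc m) 1)
    fun y hy => ?_
  by_contra h
  rw [mem_closedBall_zero_iff, not_le] at h
  exact hy (max_eq_left (by linarith))

theorem tentMass_pos (k : ℕ) : 0 < tentMass k := by
  have hcont : Continuous fun y : Euc k => max 0 (1 - ‖y‖) := by fun_prop
  exact hcont.integral_pos_of_hasCompactSupport_nonneg_nonzero (hasCompactSupport_tent k)
    (fun y => le_max_left _ _) (x := 0) (by simp)

theorem setIntegral_tent_eq (S : Gr n k) :
    ∫ y in (S.1 : Set (Euc n)), max 0 (1 - ‖y‖) ∂μHE[k] = tentMass k := by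
  let e : Euc k ≃ₗᵢ[ℝ] S.1 := ((stdOrthonormalBasis ℝ S.1).reindex (finCongr S.2)).repr.symm
  let f : Euc k → Euc n := fun z => (e z : Euc n)
  have hf : Isometry f := isometry_subtype_coe.comp e.isometry
  have hr : range f = S.1 := by
    ext x
    constructor
    · rintro ⟨z, rfl⟩
      exact (e z).2
    · intro hx
      exact ⟨e.symm ⟨x, hx⟩, by simp [f]⟩
  rw [← hr, ← hf.map_euclideanHausdorffMeasure, EuclideanSpace.euclideanHausdorffMeasure_eq_volume,
    integral_map hf.continuous.measurable.aemeasurable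
      (Continuous.aestronglyMeasurable (by fun_prop))]
  refine integral_congr_ae (Eventually.of_forall fun z => ?_)
  have : ‖f z‖ = ‖z‖ := e.norm_map z
  simp only [this]

namespace RectifiableCurrent

variable (I : RectifiableCurrent n k)

instance : IsFiniteMeasure I.varifold.toMeasure := by
  have : IsFiniteMeasure ((μHE[k] : Measure (Euc n)).withDensity
      (fun x => ENNReal.ofReal |(I.mult x : ℝ)|)) :=
    isFiniteMeasure_withDensity_ofReal I.integrable_mult.abs.2
  exact inferInstanceAs (IsFiniteMeasure (Measure.map _ _))

theorem fst_varifold : I.varifold.toMeasure.fst =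
    (μHE[k] : Measure (Euc n)).withDensity (fun x => ENNReal.ofReal |(I.mult x : ℝ)|) := by
  have hm : Measurable fun x => (x, I.plane x) := measurable_id.prodMk I.measurable_plane
  change Measure.map Prod.fst (Measure.map (fun x => (x, I.plane x)) _) = _
  rw [Measure.map_map measurable_fst hm]
  exact Measure.map_id

theorem measurable_abs_mult : Measurable fun x => ENNReal.ofReal |(I.mult x : ℝ)| :=
  ENNReal.measurable_ofReal.comp
    ((measurable_from_top (f := fun z : ℤ => |(z : ℝ)|)).comp I.measurable_mult)

theorem real_fst_varifold {A : Set (Euc n)} (hA : MeasurableSet A) :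
    I.varifold.toMeasure.fst.real A = ∫ y in A, |(I.mult y : ℝ)| ∂μHE[k] := by
  rw [fst_varifold, measureReal_def, withDensity_apply _ hA, integral_eq_lintegral_of_nonneg_ae
    (Eventually.of_forall fun y => abs_nonneg _)
    I.integrable_mult.abs.aestronglyMeasurable.restrict]

/-- Integrality and the approximate tangent planes give a lower density bound at almost every point,
which monotonicity propagates to all scales. -/
theorem ae_tentMass_le_densityRatio (hst : StationaryIn I.varifold.toMeasure (ball 0 2)) :
    ∀ᵐ x ∂I.varifold.toMeasure.fst, x ∈ ball (0 : Euc n) 2 → ∀ s, 0 < s → s < 2 - ‖x‖ →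
      tentMass k ≤ densityRatio I.varifold.toMeasure x s := by
  have hae : ∀ᵐ x ∂I.varifold.toMeasure.fst,
      tentMass k ≤ |(I.mult x : ℝ)| * tentMass k ∧
      Tendsto (fun r : ℝ => (r ^ k)⁻¹ *
        ∫ y, |(I.mult y : ℝ)| * max 0 (1 - ‖r⁻¹ • (y - x)‖) ∂μHE[k])
        (𝓝[>] 0) (𝓝 (|(I.mult x : ℝ)| * tentMass k)) := by
    rw [fst_varifold, ae_withDensity_iff I.measurable_abs_mult]
    filter_upwards [I.approx_tangent] with x hx hne
    have h0 : I.mult x ≠ 0 := fun h => hne (by simp [h])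
    have h1 := hx h0 (fun y => max 0 (1 - ‖y‖)) (by fun_prop) (hasCompactSupport_tent n)
    have h2 := setIntegral_tent_eq (I.plane x)
    simp only [plane] at h2
    rw [h2] at h1
    refine ⟨le_mul_of_one_le_left (tentMass_pos k).le ?_, h1⟩
    exact_mod_cast Int.one_le_abs h0
  filter_upwards [hae] with x hx hx2 s hs0 hs
  have hsub : ball x (2 - ‖x‖) ⊆ ball 0 2 := ball_subset_ball' (by simp)
  refine hx.1.trans (le_of_tendsto hx.2 (eventually_of_mem (Ioo_mem_nhdsGT hs0) fun r hr => ?_))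
  refine le_trans ?_ (hst.densityRatio_mono hr.1 hr.2.le hs hsub)
  have hr0 : 0 < r := hr.1
  rw [densityRatio, I.real_fst_varifold measurableSet_ball, ← integral_indicator measurableSet_ball]
  refine mul_le_mul_of_nonneg_left (integral_mono_of_nonneg
    (Eventually.of_forall fun y => mul_nonneg (abs_nonneg _) (le_max_left _ _))
    (I.integrable_mult.abs.indicator measurableSet_ball) (Eventually.of_forall fun y => ?_))
    (by positivity)
  simp only [indicator]
  split_ifs with hy
  · exact mul_le_of_le_one_right (abs_nonneg _) (max_le zero_le_one (by simp))
  · rw [mem_ball, dist_eq_norm, not_lt] at hy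
    rw [max_eq_left, mul_zero]
    rw [norm_smul, norm_inv, Real.norm_of_nonneg hr0.le, sub_nonpos, inv_mul_eq_div, one_le_div hr0]
    exact hy

end RectifiableCurrent

theorem fst_real_restrict_cyl {V : Measure (Euc n × Gr n k)} {a : Euc n} {s R : ℝ}
    (h : ball a s ⊆ ball 0 R) :
    (V.restrict (cyl n k R)).fst.real (ball a s) = V.fst.real (ball a s) := by
  rw [measureReal_def, measureReal_def, Measure.fst_apply measurableSet_ball,
    Measure.fst_apply measurableSet_ball,
    Measure.restrict_apply (measurable_fst measurableSet_ball), inter_eq_left.2]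
  exact fun p hp => ⟨h hp, mem_univ _⟩

theorem densityRatio_restrict_cyl {V : Measure (Euc n × Gr n k)} {a : Euc n} {s R : ℝ}
    (h : ball a s ⊆ ball 0 R) :
    densityRatio (V.restrict (cyl n k R)) a s = densityRatio V a s := by
  rw [densityRatio, densityRatio, fst_real_restrict_cyl h]

theorem StationaryIn.restrict_cyl {V : Measure (Euc n × Gr n k)} {R : ℝ}
    (h : StationaryIn V (ball 0 R)) : StationaryIn (V.restrict (cyl n k R)) (ball 0 R) := by
  intro X hX hc hs
  rw [setIntegral_eq_integral_of_forall_compl_eq_zero, h X hX hc hs]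
  intro p hp
  have h1 : p.1 ∉ tsupport X := fun h => hp ⟨hs h, mem_univ _⟩
  rw [fderiv_of_notMem_tsupport ℝ h1]
  simp

theorem Varifold.density_eq_densityRatio (V : Varifold n k univ) (r : ℝ) (x : Euc n) :
    V.density r x = densityRatio V.toMeasure x r := by
  rw [Varifold.density, Varifold.weight, densityRatio, measureReal_def,
    Measure.fst_apply measurableSet_ball]
  congr 4
  ext p
  simp

theorem Varifold.rescale_zero_one (V : Varifold n k univ) : V.rescale 0 1 one_pos = V := by
  ext1
  simp [Varifold.rescale]

/-- Compactness and rigidity for sequences: along an ultrafilter, stationary currents of bounded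
mass whose density ratios become constant converge on the unit ball to a cone. -/
theorem exists_conical_limit {ι : Type*} (𝒰 : Ultrafilter ι) (I : ι → RectifiableCurrent n k)
    {Λ : ℝ} (hst : ∀ i, (I i).varifold.IsStationaryIn (ball 0 2))
    (hΛ : ∀ i, (I i).varifold.weight (ball 0 2) < ENNReal.ofReal Λ) {δ r : ι → ℝ}
    (hδ : Tendsto δ 𝒰 (𝓝 0)) (hr : Tendsto r 𝒰 (𝓝 0)) (hr0 : ∀ i, 0 < r i ∧ r i < 1)
    (hpinch : ∀ i, (I i).varifold.density 1 0 - (I i).varifold.density (r i) 0 ≤ δ i) :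
    ∃ J : Varifold n k univ, J.IsConical 0 ∧
      Tendsto (fun i => ((I i).varifold.rescale 0 1 one_pos).restrictBall 1⁻¹) 𝒰
        (𝓝 (J.restrictBall 1⁻¹)) := by
  have hst' : ∀ i, StationaryIn (I i).varifold.toMeasure (ball 0 2) := hst
  let M : ι → Measure (Euc n × Gr n k) := fun i => (I i).varifold.toMeasure.restrict (cyl n k 2)
  have hMst : ∀ i, StationaryIn (M i) (ball 0 2) := fun i => (hst' i).restrict_cyl
  have hMΛ : ∀ i, (M i).real univ ≤ Λ := fun i => by
    have h1 : (M i) univ < ENNReal.ofReal Λ := by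
      simp only [M]
      rw [Measure.restrict_apply_univ]
      exact hΛ i
    exact (ENNReal.lt_ofReal_iff_toReal_lt (measure_ne_top _ _)).1 h1 |>.le
  have hMlow : ∀ i, ∀ᵐ x ∂(M i).fst, x ∈ ball (0 : Euc n) 2 → ∀ s, 0 < s → s < 2 - ‖x‖ →
      tentMass k ≤ densityRatio (M i) x s := by
    intro i
    have hle : (M i).fst ≪ (I i).varifold.toMeasure.fst :=
      Measure.restrict_le_self.absolutelyContinuous.map measurable_fst
    filter_upwards [hle.ae_le ((I i).ae_tentMass_le_densityRatio (hst' i))] with x hx hx2 s hs0 hs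
    rw [densityRatio_restrict_cyl (ball_subset_ball' (by rw [dist_zero_right]; linarith))]
    exact hx hx2 s hs0 hs
  have hMpinch : ∀ i, densityRatio (M i) 0 1 - densityRatio (M i) 0 (r i) ≤ δ i := by
    intro i
    rw [densityRatio_restrict_cyl (ball_subset_ball one_le_two),
      densityRatio_restrict_cyl (ball_subset_ball (by linarith [(hr0 i).2])),
      ← Varifold.density_eq_densityRatio, ← Varifold.density_eq_densityRatio]
    exact hpinch i
  obtain ⟨V, hVfin, hV⟩ := exists_ultrafilter_limit 𝒰 M hMΛ
  replace hV : WeakLimit 𝒰 M V := hV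
  have : Nonempty (Gr n k) := by
    obtain ⟨i⟩ := nonempty_of_neBot (𝒰 : Filter ι)
    exact ⟨(I i).plane 0⟩
  have hVst := hV.stationaryIn hMst
  obtain ⟨L, hL⟩ := hV.ball_eq hMst hMΛ hδ hr (fun i => (hr0 i).1) hMpinch
  have hcone := hVst.conicalInBall (hVst.ae_mem_plane hL)
  have hplanes := hVst.ae_eq_tangentDirections
    (div_pos (tentMass_pos k) (by positivity)) (hV.lower_density hMlow)
  obtain ⟨J, hJ, hJV⟩ := exists_conical_extension fun c hc0 hc1 =>
    hcone.map_dilation hplanes hc0 hc1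
  refine ⟨J, hJ, ?_⟩
  rw [nhds_iInf, tendsto_iInf]
  rintro ⟨φ, hφ, hc, hs⟩
  rw [nhds_induced, tendsto_comap_iff]
  rw [inv_one] at hs
  have h0 : ∀ p, p ∉ cyl n k 1 → φ p = 0 := fun p hp => by
    by_contra h
    exact hp (hs (subset_tsupport φ h))
  have h0' : ∀ p, p ∉ cyl n k 2 → φ p = 0 := fun p hp => h0 p fun h => hp (by
    rw [mem_cyl] at h ⊢; linarith)
  have h1 : ∀ W : Varifold n k univ,
      ∫ p, φ p ∂(W.restrictBall 1⁻¹).toMeasure = ∫ p in cyl n k 1, φ p ∂W.toMeasure := by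
    intro W
    simp only [Varifold.restrictBall, cyl, inv_one]
  have h2 := hV φ hφ hc
  have h3 : ∫ p, φ p ∂(J.restrictBall 1⁻¹).toMeasure = ∫ p, φ p ∂V := by
    rw [h1, hJV, setIntegral_eq_integral_of_forall_compl_eq_zero h0]
  simp only [Function.comp_def]
  rw [h3]
  refine h2.congr fun i => ?_
  rw [h1, Varifold.rescale_zero_one, setIntegral_eq_integral_of_forall_compl_eq_zero h0]
  exact setIntegral_eq_integral_of_forall_compl_eq_zero h0'

theorem Varifold.IsWeakStarDistance.eventually_lt {ι : Type*} {l : Filter ι} {U : Set (Euc n)}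
    {d : Varifold n k U → Varifold n k U → ℝ} (hd : Varifold.IsWeakStarDistance d)
    {W : ι → Varifold n k U} {J : Varifold n k U} (h : Tendsto W l (𝓝 J)) {ε : ℝ} (hε : 0 < ε) :
    ∀ᶠ i in l, d (W i) J < ε := by
  have hopen : IsOpen {Z | d J Z < ε} := by
    rw [hd.isOpen_iff]
    intro Y hY
    refine ⟨ε - d J Y, sub_pos.2 hY, fun Z hZ => ?_⟩
    have := hd.triangle J Y Z
    change d J Z < ε
    linarith
  have hmem : {Z | d J Z < ε} ∈ 𝓝 J := hopen.mem_nhds (by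
    change d J J < ε
    rwa [(hd.eq_zero_iff J J).2 rfl])
  filter_upwards [h hmem] with i hi
  rw [hd.symm]
  exact hi

/-- For fixed `k`, almost constant density ratio implies almost conical, with parameters that do
not depend on the current. -/
theorem eventually_isAlmostConical
    (d : ∀ R : ℝ, Varifold n k (ball 0 R) → Varifold n k (ball 0 R) → ℝ)
    (hd : ∀ R : ℝ, 0 < R → Varifold.IsWeakStarDistance (d R)) {Λ ε : ℝ} (hε : 0 < ε) :
    ∀ᶠ i : ℕ in atTop, ∀ I : RectifiableCurrent n k, I.varifold.IsStationaryIn (ball 0 2) →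
      I.varifold.weight (ball 0 2) < ENNReal.ofReal Λ →
      I.varifold.density 1 0 - I.varifold.density (1 / ((i : ℝ) + 1 + 1)) 0 ≤ 1 / ((i : ℝ) + 1) →
      I.varifold.IsAlmostConical d ε 1 one_pos 0 0 := by
  by_contra hcon
  rw [not_eventually] at hcon
  obtain ⟨u, hu, hbad⟩ := extraction_of_frequently_atTop hcon
  push Not at hbad
  choose I hst hΛ hpinch hnot using hbad
  have hu' : Tendsto u (Ultrafilter.of (atTop : Filter ℕ)) atTop :=
    hu.tendsto_atTop.mono_left (Ultrafilter.of_le _)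
  have hδ : Tendsto (fun j => 1 / ((u j : ℝ) + 1)) (Ultrafilter.of (atTop : Filter ℕ)) (𝓝 0) :=
    tendsto_one_div_add_atTop_nhds_zero_nat.comp hu'
  have hr : Tendsto (fun j => 1 / ((u j : ℝ) + 1 + 1)) (Ultrafilter.of (atTop : Filter ℕ))
      (𝓝 0) := by
    have h1 := (tendsto_add_atTop_iff_nat 1).2
      (tendsto_one_div_add_atTop_nhds_zero_nat (𝕜 := ℝ))
    refine (h1.comp hu').congr fun j => ?_
    simp
  obtain ⟨J, hJ, hlim⟩ := exists_conical_limit (Ultrafilter.of (atTop : Filter ℕ)) I hst hΛ hδ hr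
    (fun j => ⟨by positivity, by
      rw [div_lt_one (by positivity)]
      have : (0 : ℝ) ≤ u j := Nat.cast_nonneg _
      linarith⟩) hpinch
  obtain ⟨j, hj⟩ := ((hd 1⁻¹ (by norm_num)).eventually_lt hlim hε).exists
  exact hnot j ⟨J, hJ, hj⟩

theorem RectifiableCurrent.le_ambient (I : RectifiableCurrent n k) : k ≤ n := by
  have h := Submodule.finrank_le (I.plane 0).1
  rwa [(I.plane 0).2, finrank_euclideanSpace_fin] at h

end Rigidity

end

theorem theorem7p1 (n : ℕ)
    (d : ∀ (k : ℕ) (R : ℝ), Varifold n k (ball 0 R) → Varifold n k (ball 0 R) → ℝ)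
    (hd : ∀ (k : ℕ) (R : ℝ), 0 < R → Varifold.IsWeakStarDistance (d k R))
    (Λ ε : ℝ) (hΛ : 0 < Λ) (hε : 0 < ε) :
    ∃ δ r : ℝ, 0 < δ ∧ 0 < r ∧ r < 1 ∧
      ∀ (k : ℕ) (I : RectifiableCurrent n k), I.IsIntegral →
        I.SupportedIn (closedBall 0 2) → I.BoundarySupportedIn (sphere 0 2) →
        I.varifold.IsStationaryIn (ball 0 2) →
        I.varifold.weight (ball 0 2) < ENNReal.ofReal Λ →
        I.varifold.density 1 0 - I.varifold.density r 0 ≤ δ →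
        I.varifold.IsAlmostConical (d k) ε 1 one_pos 0 0 := by
  have h : ∀ᶠ i : ℕ in atTop, ∀ k ∈ Finset.range (n + 1), _ :=
    (Filter.eventually_all_finset _).2 fun k _ =>
      eventually_isAlmostConical (Λ := Λ) (d k) (hd k) hε
  obtain ⟨i, hi⟩ := h.exists
  refine ⟨1 / ((i : ℝ) + 1), 1 / ((i : ℝ) + 1 + 1), by positivity, by positivity, ?_, ?_⟩
  · rw [div_lt_one (by positivity)]
    have : (0 : ℝ) ≤ i := Nat.cast_nonneg _
    linarith
  · intro k I _ _ _ hst hmass hpinch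
    exact hi k (Finset.mem_range.2 (Nat.lt_succ_of_le I.le_ambient)) I hst hmass hpinch
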